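/- Let $V$ be a countably infinite set and let $b : V \times V \to [0,\infty)$ satisfy $b(x,x)=0$, $b(x,y)=b(y,x)$ and $\deg(x) := \sum_{z\in V} b(x,z) < \infty$ for all $x,y \in V$. Assume that the weighted graph $(b,0)$ is connected, i.e. any two vertices can be joined by a finite path $x_0,\dots,x_n$ with $b(x_{j},x_{j+1})>0$ for $0\le j<n$. For $u : V \to \mathbb{R}$ put $$\widetilde Q(u) = \tfrac12 \sum_{x,y\in V} b(x,y)(u(x)-u(y))^2 \in [0,\infty],$$ and write $\widetilde Q(u,v) = \tfrac12\sum_{x,y\in V} b(x,y)(u(x)-u(y))(v(x)-v(y))$ for functions $u,v$ of finite energy. Consider $\ell^2(V) = \ell^2(V,m)$ with $m\equiv 1$, with inner product $\langle\cdot,\cdot\rangle$ and norm $\|\cdot\|_2$. Let $Q^D$ be the restriction of $\widetilde Q$ to the domain $D(Q^D)$ that is the closure of the finitely supported functions in $\{u \in \ell^2(V) : \widetilde Q(u)<\infty\}$ with respect to the norm $(\widetilde Q(u) + \|u\|_2^2)^{1/2}$. Let $L^D$ be the operator on $\ell^2(V)$ associated with $Q^D$: $u\in D(L^D)$ and $L^D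 u = w$ if and only if $u \in D(Q^D)$, $w\in\ell^2(V)$ and $Q^D(u,v) = \langle w, v\rangle$ for all $v\in D(Q^D)$. Then there is exactly one strongly continuous semigroup $(e^{-tL^D})_{t\ge 0}$ of bounded operators on $\ell^2(V)$ with generator $-L^D$; it satisfies $e^{-tL^D}\delta_x(y)\ge 0$ for all $t\ge0$ and $x,y\in V$; and for all $x,y\in V$, as an identity in $[0,\infty]$, $$\int_0^\infty e^{-tL^D}\delta_x(y)\,dt = \frac{1}{\deg(x)} \sum_{n=0}^\infty P^{(n)}(y,x),$$ where $P(x,y) = b(x,y)/\deg(x)$ is the transition matrix of the random walk on $(b,0)$, $P^{(n)}$ is its $n$-th matrix power, and $\delta_x$ is the function that is $1$ at $x$ and $0$ elsewhere. -/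

import Mathlib

open Set Filter Topology MeasureTheory
open scoped NNReal ENNReal

noncomputable section

/-- A weighted graph `(b, 0)` over `V` (no killing term): symmetric edge weights with values in
`[0, ∞)`, vanishing on the diagonal and summable at every vertex. Local finiteness is not
required. -/
structure WeightedGraph (V : Type*) where
  b : V → V → ℝ≥0
  b_self : ∀ x, b x x = 0
  b_symm : ∀ x y, b x y = b y x
  b_summable : ∀ x, Summable (b x)

/-- The real Hilbert space `ℓ²(V, 1)`. -/
abbrev EllTwo (V : Type*) := lp (fun _ : V => ℝ) 2

open Classical in
/-- The function `δ_x`, as an element of `ℓ²(V, 1)`. -/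
def delta {V : Type*} (x : V) : EllTwo V := lp.single 2 x (1 : ℝ)

namespace WeightedGraph

variable {V : Type*} (G : WeightedGraph V)

/-- Any two vertices are joined by a finite path along edges of positive weight. -/
def Connected : Prop := ∀ x y, Relation.ReflTransGen (fun z w => 0 < G.b z w) x y

/-- The vertex degree `deg x = ∑_y b(x, y)`. -/
def deg (x : V) : ℝ≥0 := ∑' y, G.b x y

/-- The transition matrix `P(x, y) = b(x, y) / deg x`. -/
def transition (x y : V) : ℝ≥0 := G.b x y / G.deg x

open Classical in
/-- The entries of the `n`-th power of the (infinite) transition matrix. -/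
def transitionPow : ℕ → V → V → ℝ≥0
  | 0 => fun x y => if x = y then 1 else 0
  | n + 1 => fun x y => ∑' z, G.transition x z * transitionPow n z y

/-- The energy `½ ∑_{x,y} b(x,y) (u x - u y)²` in `[0, ∞]`, of an arbitrary function. -/
def energy (u : V → ℝ) : ℝ≥0∞ :=
  (1 / 2) * ∑' p : V × V, (G.b p.1 p.2 : ℝ≥0∞) * ENNReal.ofReal ((u p.1 - u p.2) ^ 2)

/-- The bilinear form `½ ∑_{x,y} b(x,y) (u x - u y) (v x - v y)`; the sum converges absolutely
when `u` and `v` have finite energy. -/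
def form (u v : V → ℝ) : ℝ :=
  (1 / 2) * ∑' p : V × V, (G.b p.1 p.2 : ℝ) * ((u p.1 - u p.2) * (v p.1 - v p.2))

/-- The domain of the regular Dirichlet form `Q^D`: the closure of the finitely supported functions
in the space of `ℓ²`-functions of finite energy, with respect to the form norm
`(energy u + ‖u‖²)^{1/2}`. The form `Q^D` itself is `form` restricted to this domain. -/
def formDomain : Set (EllTwo V) :=
  {u | G.energy u < ∞ ∧ ∀ ε : ℝ≥0∞, 0 < ε →
    ∃ φ : EllTwo V, (Function.support (φ : V → ℝ)).Finite ∧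
      G.energy ((u - φ : EllTwo V) : V → ℝ) + ENNReal.ofReal (‖u - φ‖ ^ 2) < ε}

/-- The operator `L^D` associated with the form `Q^D`, given by its graph: `u ∈ D(L^D)` and
`L^D u = w` if and only if `u ∈ D(Q^D)` and `Q^D(u, v) = ⟪w, v⟫` for all `v ∈ D(Q^D)`. -/
def dirichletOperator : Set (EllTwo V × EllTwo V) :=
  {p | p.1 ∈ G.formDomain ∧ ∀ v ∈ G.formDomain, G.form p.1 v = inner ℝ p.2 v}

end WeightedGraph

/-- `T` is a strongly continuous semigroup of bounded operators whose infinitesimal generator is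
exactly `-L`, where the operator `L` is given by its graph. -/
structure IsSemigroupGeneratedByNeg {H : Type*} [NormedAddCommGroup H] [NormedSpace ℝ H]
    (L : Set (H × H)) (T : ℝ≥0 → H →L[ℝ] H) : Prop where
  map_zero : T 0 = ContinuousLinearMap.id ℝ H
  map_add : ∀ s t, T (s + t) = (T s).comp (T t)
  tendsto_zero : ∀ f, Tendsto (fun t => T t f) (𝓝 0) (𝓝 f)
  generator : ∀ u w, (u, w) ∈ L ↔
    Tendsto (fun t : ℝ≥0 => (t : ℝ)⁻¹ • (u - T t u)) (𝓝[>] 0) (𝓝 w)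

open Classical in
/-- `expNeg L t` is `e^{-tL}`: the strongly continuous semigroup generated by `-L` (and `0` if `-L`
generates no such semigroup). -/
def expNeg {H : Type*} [NormedAddCommGroup H] [NormedSpace ℝ H] (L : Set (H × H)) :
    ℝ≥0 → H →L[ℝ] H :=
  if h : ∃ T : ℝ≥0 → H →L[ℝ] H, IsSemigroupGeneratedByNeg L T then h.choose else 0

end

/-! The operator is realised as a linear relation built from the gradient closed on finitely
supported functions. Orthogonal projection onto that closed graph solves `(α + L)u = f` for every `α
> 0`, so the relation is maximal monotone (`isMaximalMonotone_formRelation`). The Hille-Yosida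
argument (`exists_semigroup`) then yields a contraction semigroup, unique because the difference of
two orbits has nonincreasing norm, and its Laplace transform is the resolvent
(`integral_exp_mul_semigroup`).

The formula is first proved for each `α > 0`, with `e^{-αt}` on the left and the walk killed at rate
`α` on the right (`ofReal_resolvent_delta`). The Neumann series is the least solution in `[0, ∞]` of
`(lap + α)U = δ_x`, so it lies below the resolvent `u` of `δ_x`. It is therefore a bounded solution,
and the domination principle `le_of_lap_add_le` puts `u` below it. This principle rests on
approximation by finitely supported functions, i.e. on the Dirichlet choice of form domain.

As `α` decreases to `0` both sides increase, and monotone convergence gives the identity in `[0,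
∞]`, whether finite or not. Connectedness provides the positive degrees that turn `b(y,z)/deg y`
into transition probabilities. -/

noncomputable section

/-! ### Norm decay along dissipative curves. -/

/-- A function whose right derivative makes an obtuse angle with it has nonincreasing norm. -/
theorem norm_le_of_inner_deriv_right_nonpos {H : Type*} [NormedAddCommGroup H]
    [InnerProductSpace ℝ H] {f f' : ℝ → H} {t : ℝ} (ht : 0 ≤ t) (hf : ContinuousOn f (Icc 0 t))
    (hf' : ∀ s ∈ Ico 0 t, HasDerivWithinAt f (f' s) (Ici s) s)
    (h : ∀ s ∈ Ico 0 t, inner ℝ (f' s) (f s) ≤ 0) : ‖f t‖ ≤ ‖f 0‖ := by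
  have key : ‖f t‖ ^ 2 ≤ ‖f 0‖ ^ 2 := by
    -- Semigroup orbits will only have right derivatives, so `‖f‖²` is compared with a constant by
    -- the one-sided mean value inequality.
    refine image_le_of_liminf_slope_right_le_deriv_boundary (f := fun s => ‖f s‖ ^ 2)
      (B := fun _ => ‖f 0‖ ^ 2) (B' := fun _ => 0) (a := 0) (b := t) (hf.norm.pow 2) le_rfl
      continuousOn_const (fun s _ => hasDerivWithinAt_const _ _ _) ?_ ⟨ht, le_rfl⟩
    intro s hs r hr
    refine ((hf' s hs).norm_sq).liminf_right_slope_le (lt_of_le_of_lt ?_ hr)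
    rw [real_inner_comm]
    linarith [h s hs]
  exact le_of_sq_le_sq key (norm_nonneg _)

/-! ### Orbits of strongly continuous semigroups. -/

namespace IsSemigroupGeneratedByNeg

variable {H : Type*} [NormedAddCommGroup H] [InnerProductSpace ℝ H] {L : Set (H × H)}
  {T : ℝ≥0 → H →L[ℝ] H}

theorem apply_zero (hT : IsSemigroupGeneratedByNeg L T) (u : H) : T 0 u = u := by
  simp [hT.map_zero]

theorem apply_add (hT : IsSemigroupGeneratedByNeg L T) (s t : ℝ≥0) (u : H) :
    T (s + t) u = T s (T t u) := by
  simp [hT.map_add]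

/-- Otherwise the norms are unbounded along some `t n → 0`, while each orbit converges along this
sequence; this contradicts Banach-Steinhaus. -/
theorem exists_norm_le [CompleteSpace H] (hT : IsSemigroupGeneratedByNeg L T) :
    ∃ δ : ℝ≥0, 0 < δ ∧ ∃ M : ℝ, ∀ t ≤ δ, ‖T t‖ ≤ M := by
  by_contra! hcon
  have hex : ∀ n : ℕ, ∃ t : ℝ≥0, t ≤ 1 / ((n : ℝ≥0) + 1) ∧ (n : ℝ) < ‖T t‖ := fun n =>
    hcon _ (by positivity) n
  choose t ht hn using hex
  have ht0 : Tendsto t atTop (𝓝 0) :=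
    tendsto_of_tendsto_of_tendsto_of_le_of_le tendsto_const_nhds
      (tendsto_one_div_add_atTop_nhds_zero_nat (𝕜 := ℝ≥0)) (fun _ => zero_le) ht
  obtain ⟨C, hC⟩ := banach_steinhaus (g := fun n => T (t n)) fun u => by
    have := ((hT.tendsto_zero u).comp ht0).norm.bddAbove_range
    obtain ⟨C, hC⟩ := this
    exact ⟨C, fun n => hC ⟨n, rfl⟩⟩
  obtain ⟨n, hn'⟩ := exists_nat_gt C
  exact absurd (hC n) (not_le.2 (hn'.trans (hn n)))

theorem continuous_orbit [CompleteSpace H] (hT : IsSemigroupGeneratedByNeg L T) (u : H) :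
    Continuous fun t => T t u := by
  obtain ⟨δ, hδ, M, hM⟩ := hT.exists_norm_le
  have hM0 : 0 ≤ M := (norm_nonneg _).trans (hM 0 zero_le)
  refine continuous_iff_continuousAt.2 fun t => ?_
  rw [ContinuousAt, tendsto_iff_norm_sub_tendsto_zero]
  have hnn : Tendsto (fun s => nndist s t) (𝓝 t) (𝓝 0) := by
    have : Continuous fun s : ℝ≥0 => nndist s t := by fun_prop
    simpa using this.tendsto t
  have hlim : Tendsto (fun s => (‖T (t - δ)‖ * M) * ‖T (nndist s t) u - u‖) (𝓝 t) (𝓝 0) := by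
    have := ((((hT.tendsto_zero u).comp hnn).sub_const u).norm).const_mul (‖T (t - δ)‖ * M)
    simpa using this
  refine squeeze_zero' (Eventually.of_forall fun _ => norm_nonneg _) ?_ hlim
  -- The subtraction is truncated: for `t ≤ δ` the bound reads `0 ≤ s`. In both cases `min s t`
  -- exceeds `t - δ` by at most `δ`, where the local norm bound applies.
  have hev : ∀ᶠ s in 𝓝 t, t - δ ≤ s := by
    rcases le_total t δ with h | h
    · simp [tsub_eq_zero_of_le h]
    · exact eventually_ge_nhds (tsub_lt_self (hδ.trans_le h) hδ)
  filter_upwards [hev] with s hs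
  have hmin : ‖T (min s t)‖ ≤ ‖T (t - δ)‖ * M := by
    have h1 : min s t = (t - δ) + (min s t - (t - δ)) :=
      (add_tsub_cancel_of_le (le_min hs tsub_le_self)).symm
    rw [h1, hT.map_add]
    refine (ContinuousLinearMap.opNorm_comp_le _ _).trans ?_
    gcongr
    refine hM _ ?_
    rw [tsub_le_iff_right]
    refine (min_le_right _ _).trans ?_
    exact le_add_tsub
  have hdiff : ‖T s u - T t u‖ = ‖T (min s t) (T (nndist s t) u - u)‖ := by
    rcases le_total s t with h | h
    · have : t = s + nndist s t := by
        ext; simp [NNReal.dist_eq, abs_of_nonpos (sub_nonpos.2 (NNReal.coe_le_coe.2 h))]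
      conv_lhs => rw [this, hT.apply_add]
      rw [min_eq_left h, map_sub, norm_sub_rev]
    · have : s = t + nndist s t := by
        ext; simp [NNReal.dist_eq, abs_of_nonneg (sub_nonneg.2 (NNReal.coe_le_coe.2 h))]
      conv_lhs => rw [this, hT.apply_add]
      rw [min_eq_right h, map_sub]
  rw [hdiff]
  exact (ContinuousLinearMap.le_opNorm _ _).trans (by gcongr)

theorem continuous_orbit_real [CompleteSpace H] (hT : IsSemigroupGeneratedByNeg L T) (u : H) :
    Continuous fun t : ℝ => T t.toNNReal u :=
  (hT.continuous_orbit u).comp continuous_real_toNNReal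

theorem apply_mem (hT : IsSemigroupGeneratedByNeg L T) {u w : H} (h : (u, w) ∈ L) (t : ℝ≥0) :
    (T t u, T t w) ∈ L := by
  rw [hT.generator] at h ⊢
  refine (((T t).continuous.tendsto w).comp h).congr fun s => ?_
  simp only [Function.comp_apply, map_smul, map_sub, ← hT.apply_add, add_comm]

theorem hasDerivWithinAt (hT : IsSemigroupGeneratedByNeg L T) {u w : H} (h : (u, w) ∈ L) {t : ℝ}
    (ht : 0 ≤ t) :
    HasDerivWithinAt (fun s : ℝ => T s.toNNReal u) (-(T t.toNNReal w)) (Ici t) t := by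
  rw [← hasDerivWithinAt_Ioi_iff_Ici, hasDerivWithinAt_iff_tendsto_slope' self_notMem_Ioi]
  have h1 := (hT.generator _ _).1 (hT.apply_mem h t.toNNReal)
  have h2 : Tendsto (fun s : ℝ => (s - t).toNNReal) (𝓝[>] t) (𝓝[>] 0) := by
    refine tendsto_nhdsWithin_iff.2 ⟨?_, ?_⟩
    · have : Continuous fun s : ℝ => (s - t).toNNReal := by fun_prop
      simpa using (this.tendsto t).mono_left nhdsWithin_le_nhds
    · filter_upwards [self_mem_nhdsWithin] with s hs
      simpa using hs
  refine (h1.comp h2).neg.congr' ?_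
  filter_upwards [self_mem_nhdsWithin] with s hs
  have hs' : 0 ≤ s - t := sub_nonneg.2 (le_of_lt hs)
  have h3 : s.toNNReal = (s - t).toNNReal + t.toNNReal := by
    rw [← Real.toNNReal_add hs' ht, sub_add_cancel]
  simp only [Function.comp_apply, slope, vsub_eq_sub, Real.coe_toNNReal _ hs', ← smul_neg, neg_sub]
  rw [h3, hT.apply_add]

end IsSemigroupGeneratedByNeg

/-! ### Maximal monotone relations and their resolvents. -/

/-- A linear relation `L` on a Hilbert space which is monotone and single-valued and for which
`α + L` is onto for all `α > 0`. -/
structure IsMaximalMonotone {H : Type*} [NormedAddCommGroup H] [InnerProductSpace ℝ H]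
    (L : Submodule ℝ (H × H)) : Prop where
  inner_nonneg : ∀ u w, (u, w) ∈ L → 0 ≤ inner ℝ w u
  exists_add_eq : ∀ α : ℝ, 0 < α → ∀ f, ∃ u w, (u, w) ∈ L ∧ α • u + w = f
  single_valued : ∀ w, ((0 : H), w) ∈ L → w = 0

open Classical in
/-- The resolvent `(α + L)⁻¹` of a linear relation `L`. -/
def relResolvent {H : Type*} [NormedAddCommGroup H] [InnerProductSpace ℝ H]
    (L : Submodule ℝ (H × H)) (α : ℝ) : H →L[ℝ] H :=
  if h : ∃ R : H →L[ℝ] H, ∀ f, (R f, f - α • R f) ∈ L then h.choose else 0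

namespace IsMaximalMonotone

variable {H : Type*} [NormedAddCommGroup H] [InnerProductSpace ℝ H] {L : Submodule ℝ (H × H)}

theorem eq_of_add_eq (hL : IsMaximalMonotone L) {α : ℝ} (hα : 0 < α) {u w u' w' : H}
    (h : (u, w) ∈ L) (h' : (u', w') ∈ L) (he : α • u + w = α • u' + w') : u = u' := by
  have h1 := hL.inner_nonneg _ _ (L.sub_mem h h')
  have h2 : w - w' = -(α • (u - u')) := by
    rw [smul_sub]; 
    rw [eq_neg_iff_add_eq_zero, ← sub_eq_zero.2 he]; abel
  rw [h2, inner_neg_left, real_inner_smul_left, real_inner_self_eq_norm_sq] at h1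
  have h3 : ‖u - u'‖ ^ 2 ≤ 0 := by
    by_contra hcon
    have := mul_pos hα (not_le.1 hcon)
    linarith
  exact sub_eq_zero.1 (norm_eq_zero.1 (pow_eq_zero_iff two_ne_zero |>.1
    (le_antisymm h3 (sq_nonneg _))))

theorem mul_norm_le (hL : IsMaximalMonotone L) {α : ℝ} {u w : H} (h : (u, w) ∈ L) :
    α * ‖u‖ ≤ ‖α • u + w‖ := by
  rcases eq_or_ne u 0 with rfl | hu
  · simp
  have h1 := hL.inner_nonneg _ _ h
  have h2 : α * ‖u‖ ^ 2 ≤ inner ℝ (α • u + w) u := by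
    rw [inner_add_left, real_inner_smul_left, real_inner_self_eq_norm_sq]
    linarith
  have h3 := real_inner_le_norm (α • u + w) u
  have h4 : 0 < ‖u‖ := norm_pos_iff.2 hu
  refine le_of_mul_le_mul_right ?_ h4
  nlinarith

theorem exists_resolvent (hL : IsMaximalMonotone L) {α : ℝ} (hα : 0 < α) :
    ∃ R : H →L[ℝ] H, ∀ f, (R f, f - α • R f) ∈ L := by
  choose R w hR hw using hL.exists_add_eq α hα
  have hR' : ∀ f, (R f, f - α • R f) ∈ L := fun f => by
    have : f - α • R f = w f := sub_eq_iff_eq_add'.2 (hw f).symm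
    rw [this]; exact hR f
  let R₀ : H →ₗ[ℝ] H :=
    { toFun := R
      map_add' := fun f g => hL.eq_of_add_eq hα (hR' (f + g)) (L.add_mem (hR' f) (hR' g)) (by
        simp only [smul_add]; abel)
      map_smul' := fun c f => hL.eq_of_add_eq hα (hR' (c • f)) (L.smul_mem c (hR' f)) (by
        simp only [RingHom.id_apply, smul_sub, smul_comm α c]; abel) }
  refine ⟨R₀.mkContinuous α⁻¹ fun f => ?_, hR'⟩
  have h := hL.mul_norm_le (α := α) (hR' f)
  rw [add_sub_cancel] at h
  rw [inv_mul_eq_div, le_div_iff₀ hα, mul_comm]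
  exact h

theorem resolvent_mem (hL : IsMaximalMonotone L) {α : ℝ} (hα : 0 < α) (f : H) :
    (relResolvent L α f, f - α • relResolvent L α f) ∈ L := by
  have h := hL.exists_resolvent hα
  rw [relResolvent, dif_pos h]
  exact h.choose_spec f

theorem resolvent_eq (hL : IsMaximalMonotone L) {α : ℝ} (hα : 0 < α) {u w : H}
    (h : (u, w) ∈ L) : relResolvent L α (α • u + w) = u :=
  hL.eq_of_add_eq hα (hL.resolvent_mem hα _) h (by simp)

theorem norm_smul_resolvent_le (hL : IsMaximalMonotone L) {α : ℝ} (hα : 0 < α) :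
    ‖α • relResolvent L α‖ ≤ 1 := by
  refine ContinuousLinearMap.opNorm_le_bound _ zero_le_one fun f => ?_
  have h := hL.mul_norm_le (α := α) (hL.resolvent_mem hα f)
  rw [add_sub_cancel] at h
  simpa [norm_smul, abs_of_pos hα] using h

/-- The resolvent at `β` of `f` also solves the equation at `α`, with right-hand side `f + (α - β)
R_β f`. -/
theorem resolvent_sub_resolvent (hL : IsMaximalMonotone L) {α β : ℝ} (hα : 0 < α) (hβ : 0 < β)
    (f : H) : relResolvent L β f - relResolvent L α f =
      (α - β) • relResolvent L α (relResolvent L β f) := by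
  have h := hL.resolvent_eq hα (hL.resolvent_mem hβ f)
  have h2 : α • relResolvent L β f + (f - β • relResolvent L β f) =
      f + (α - β) • relResolvent L β f := by rw [sub_smul]; abel
  rw [h2, map_add, map_smul] at h
  rw [← h, add_sub_cancel_left, h]

theorem resolvent_commute (hL : IsMaximalMonotone L) {α β : ℝ} (hα : 0 < α) (hβ : 0 < β) :
    Commute (relResolvent L α) (relResolvent L β) := by
  rcases eq_or_ne α β with rfl | hne
  · exact Commute.refl _
  ext f
  simp only [mul_apply_eq_comp]
  have h1 := hL.resolvent_sub_resolvent hα hβ f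
  have h2 := hL.resolvent_sub_resolvent hβ hα f
  refine smul_right_injective H (sub_ne_zero.2 hne) ?_
  simp only
  rw [← h1, ← neg_sub β α, neg_smul, ← h2, neg_sub]

/-- If `h` is orthogonal to the domain, take `u = (1 + L)⁻¹ h`. Monotonicity gives `0 ≤ ⟪h - u, u⟫ =
-‖u‖²`, so `u = 0`, hence `(0, h) ∈ L` and `h = 0` by single-valuedness. -/
theorem dense_fst (hL : IsMaximalMonotone L) [CompleteSpace H] :
    Dense {u : H | ∃ w, (u, w) ∈ L} := by
  have h : (L.map (LinearMap.fst ℝ H H)).topologicalClosure = ⊤ := by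
    rw [Submodule.topologicalClosure_eq_top_iff, Submodule.eq_bot_iff]
    intro h hh
    rw [Submodule.mem_orthogonal] at hh
    have h1 := hL.resolvent_mem one_pos h
    have h2 := hh _ ⟨_, h1, rfl⟩
    have h3 := hL.inner_nonneg _ _ h1
    simp only [LinearMap.fst_apply] at h2
    rw [one_smul, inner_sub_left, real_inner_comm, h2, real_inner_self_eq_norm_sq] at h3
    have h4 : relResolvent L 1 h = 0 := by
      rw [← norm_eq_zero]
      exact pow_eq_zero_iff two_ne_zero |>.1 (by nlinarith [sq_nonneg ‖relResolvent L 1 h‖])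
    rw [h4] at h1
    simpa using hL.single_valued _ h1
  have h' := Submodule.dense_iff_topologicalClosure_eq_top.2 h
  refine h'.mono ?_
  rintro u ⟨⟨u', w⟩, hp, rfl⟩
  exact ⟨w, hp⟩

theorem semigroup_unique [CompleteSpace H] (hL : IsMaximalMonotone L)
    {S T : ℝ≥0 → H →L[ℝ] H} (hS : IsSemigroupGeneratedByNeg (L : Set (H × H)) S)
    (hT : IsSemigroupGeneratedByNeg (L : Set (H × H)) T) : S = T := by
  ext1 t
  refine ContinuousLinearMap.coeFn_injective
    (Continuous.ext_on hL.dense_fst (S t).continuous (T t).continuous ?_)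
  rintro u ⟨w, hu⟩
  have h := norm_le_of_inner_deriv_right_nonpos (t := t) t.2
    (f := fun s : ℝ => S s.toNNReal u - T s.toNNReal u)
    (f' := fun s => -(S s.toNNReal w) - -(T s.toNNReal w))
    ((hS.continuous_orbit_real u).sub (hT.continuous_orbit_real u)).continuousOn
    (fun s hs => (hS.hasDerivWithinAt hu hs.1).sub (hT.hasDerivWithinAt hu hs.1))
    (fun s _ => by
      have := hL.inner_nonneg _ _ (L.sub_mem (hS.apply_mem hu s.toNNReal)
        (hT.apply_mem hu s.toNNReal))
      rw [← neg_sub', inner_neg_left]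
      linarith)
  simp only [Real.toNNReal_coe, Real.toNNReal_zero, hS.apply_zero, hT.apply_zero, sub_self,
    norm_zero, norm_le_zero_iff] at h
  exact sub_eq_zero.1 h

theorem norm_semigroup_apply_le [CompleteSpace H] (hL : IsMaximalMonotone L)
    {T : ℝ≥0 → H →L[ℝ] H} (hT : IsSemigroupGeneratedByNeg (L : Set (H × H)) T) (t : ℝ≥0) (u : H) :
    ‖T t u‖ ≤ ‖u‖ := by
  refine hL.dense_fst.induction (P := fun u => ‖T t u‖ ≤ ‖u‖) ?_
    (isClosed_le (T t).continuous.norm continuous_norm) u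
  rintro u ⟨w, hu⟩
  have h := norm_le_of_inner_deriv_right_nonpos (t := t) t.2
    (f := fun s : ℝ => T s.toNNReal u) (f' := fun s => -(T s.toNNReal w))
    (hT.continuous_orbit_real u).continuousOn
    (fun s hs => hT.hasDerivWithinAt hu hs.1)
    (fun s _ => by
      have := hL.inner_nonneg _ _ (hT.apply_mem hu s.toNNReal)
      rw [inner_neg_left]
      linarith)
  simpa [hT.apply_zero] using h

end IsMaximalMonotone

/-! ### Exponentials, Yosida approximation and the Hille-Yosida theorem. -/

theorem norm_exp_neg_smul_apply_le {H : Type*} [NormedAddCommGroup H] [InnerProductSpace ℝ H]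
    [CompleteSpace H] {A : H →L[ℝ] H} (hA : ∀ u, 0 ≤ inner ℝ (A u) u) {t : ℝ} (ht : 0 ≤ t)
    (u : H) : ‖NormedSpace.exp (-(t • A)) u‖ ≤ ‖u‖ := by
  have hd : ∀ s : ℝ, HasDerivAt (fun s : ℝ => NormedSpace.exp (-(s • A)) u)
      (-(A (NormedSpace.exp (-(s • A)) u))) s := fun s => by
    have h := (hasDerivAt_exp_smul_const' (𝕂 := ℝ) (-A) s).clm_apply (hasDerivAt_const s u)
    simpa [smul_neg] using h
  have h := norm_le_of_inner_deriv_right_nonpos ht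
    (fun s _ => (hd s).continuousAt.continuousWithinAt) (fun s _ => (hd s).hasDerivWithinAt)
    (fun s _ => by
      rw [inner_neg_left]
      exact neg_nonpos.2 (hA _))
  simpa using h

theorem exp_add_of_commute_real {A : Type*} [NormedRing A] [NormedAlgebra ℝ A] [CompleteSpace A]
    {x y : A} (h : Commute x y) :
    NormedSpace.exp (x + y) = NormedSpace.exp x * NormedSpace.exp y := by
  let : NormedAlgebra ℚ A := NormedAlgebra.restrictScalars ℚ ℝ A
  exact NormedSpace.exp_add_of_commute h

/-- The curve `s ↦ e^{-(t-s)B} e^{-sA} u` joins the two vectors. Since `A` and `B` commute, its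
velocity is a contraction applied to `(B - A)u`. -/
theorem norm_exp_neg_smul_sub_le {H : Type*} [NormedAddCommGroup H] [InnerProductSpace ℝ H]
    [CompleteSpace H] {A B : H →L[ℝ] H} (hA : ∀ u, 0 ≤ inner ℝ (A u) u)
    (hB : ∀ u, 0 ≤ inner ℝ (B u) u) (hAB : Commute A B) {t : ℝ} (ht : 0 ≤ t) (u : H) :
    ‖NormedSpace.exp (-(t • A)) u - NormedSpace.exp (-(t • B)) u‖ ≤ t * ‖A u - B u‖ := by
  let E : ℝ → H →L[ℝ] H := fun s => NormedSpace.exp (s • (B - A))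
  have hE : ∀ s, NormedSpace.exp (-(t • B)) * E s =
      NormedSpace.exp (-((t - s) • B)) * NormedSpace.exp (-(s • A)) := fun s => by
    have hBB : Commute (-(t • B)) (s • (B - A)) :=
      (((Commute.refl B).sub_right hAB.symm).smul_left t |>.neg_left).smul_right s
    have hBA : Commute (-((t - s) • B)) (-(s • A)) :=
      ((hAB.symm.smul_left (t - s)).smul_right s).neg_left.neg_right
    rw [← exp_add_of_commute_real hBB, ← exp_add_of_commute_real hBA]
    congr 1
    module
  have hd : ∀ s : ℝ, HasDerivAt (fun s : ℝ => (NormedSpace.exp (-(t • B)) * E s) u)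
      ((NormedSpace.exp (-(t • B)) * E s) ((B - A) u)) s := fun s => by
    have h := (hasDerivAt_exp_smul_const (𝕂 := ℝ) (B - A) s).const_mul
      (NormedSpace.exp (-(t • B)))
    simpa [E] using h.clm_apply (hasDerivAt_const s u)
  have h := norm_image_sub_le_of_norm_deriv_right_le_segment (a := 0) (b := t)
    (fun s _ => (hd s).continuousAt.continuousWithinAt) (fun s _ => (hd s).hasDerivWithinAt)
    (C := ‖A u - B u‖) (fun s hs => by
      rw [hE, mul_apply_eq_comp, norm_sub_rev (A u)]
      refine (norm_exp_neg_smul_apply_le hB (sub_nonneg.2 hs.2.le) _).trans ?_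
      exact norm_exp_neg_smul_apply_le hA hs.1 _) t ⟨ht, le_rfl⟩
  rw [hE, hE] at h
  simpa [mul_comm] using h

/-- The Yosida approximation `α - α² (α + L)⁻¹` of a linear relation `L`. -/
def yosida {H : Type*} [NormedAddCommGroup H] [InnerProductSpace ℝ H]
    (L : Submodule ℝ (H × H)) (α : ℝ) : H →L[ℝ] H :=
  α • (1 - α • relResolvent L α)

namespace IsMaximalMonotone

variable {H : Type*} [NormedAddCommGroup H] [InnerProductSpace ℝ H] {L : Submodule ℝ (H × H)}

theorem inner_yosida_nonneg (hL : IsMaximalMonotone L) {α : ℝ} (hα : 0 < α) (u : H) :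
    0 ≤ inner ℝ (yosida L α u) u := by
  have h1 : inner ℝ ((α • relResolvent L α) u) u ≤ ‖u‖ * ‖u‖ := by
    refine (real_inner_le_norm _ _).trans ?_
    gcongr
    exact (ContinuousLinearMap.le_of_opNorm_le _ (hL.norm_smul_resolvent_le hα) u).trans
      (one_mul _).le
  have h2 : yosida L α u = α • (u - (α • relResolvent L α) u) := rfl
  rw [h2, real_inner_smul_left, inner_sub_left, real_inner_self_eq_norm_mul_norm]
  exact mul_nonneg hα.le (sub_nonneg.2 h1)

theorem yosida_commute (hL : IsMaximalMonotone L) {α β : ℝ} (hα : 0 < α) (hβ : 0 < β) :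
    Commute (yosida L α) (yosida L β) := by
  have h := ((hL.resolvent_commute hα hβ).smul_left α).smul_right β
  exact ((((Commute.one_left _).sub_left ((Commute.one_right _).sub_right h)).smul_left
    α).smul_right β)

theorem yosida_apply (hL : IsMaximalMonotone L) {α : ℝ} (hα : 0 < α) {u w : H}
    (h : (u, w) ∈ L) : yosida L α u = α • relResolvent L α w := by
  have h1 := hL.resolvent_eq hα h
  rw [map_add, map_smul] at h1
  have h2 : yosida L α u = α • (u - α • relResolvent L α u) := rfl
  rw [h2, ← eq_sub_of_add_eq' h1]

theorem tendsto_smul_resolvent [CompleteSpace H] (hL : IsMaximalMonotone L) (u : H) :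
    Tendsto (fun α : ℝ => α • relResolvent L α u) atTop (𝓝 u) := by
  rw [Metric.tendsto_atTop]
  intro ε hε
  obtain ⟨v, ⟨w, hv⟩, hvu⟩ := hL.dense_fst.exists_dist_lt u (ε := ε / 4) (by positivity)
  -- On the domain the error is `R_α w`, of norm at most `‖w‖ / α`; this threshold makes it at most
  -- `ε / 4`, and the `+ 1` keeps `α` positive when `w = 0`.
  refine ⟨4 * (‖w‖ + 1) / ε, fun α hα' => ?_⟩
  have hα : 0 < α := lt_of_lt_of_le (by positivity) hα'
  have h1 : α • relResolvent L α v = v - relResolvent L α w := by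
    have h1 := hL.resolvent_eq hα hv
    rw [map_add, map_smul] at h1
    exact eq_sub_of_add_eq h1
  have hbd : ∀ f, ‖α • relResolvent L α f‖ ≤ ‖f‖ := fun f =>
    (ContinuousLinearMap.le_of_opNorm_le _ (hL.norm_smul_resolvent_le hα) f).trans
      (one_mul _).le
  have h2 : ‖relResolvent L α w‖ ≤ ε / 4 := by
    have := hbd w
    rw [norm_smul, Real.norm_of_nonneg hα.le] at this
    rw [ge_iff_le, div_le_iff₀ hε] at hα'
    refine le_of_mul_le_mul_left (this.trans ?_) hα
    nlinarith
  have h3 := hbd (u - v)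
  have h4 : α • relResolvent L α u - u =
      α • relResolvent L α (u - v) - relResolvent L α w - (u - v) := by
    rw [map_sub, smul_sub, h1]; abel
  rw [dist_eq_norm] at hvu ⊢
  rw [h4]
  have h5 := norm_sub_le (α • relResolvent L α (u - v) - relResolvent L α w) (u - v)
  have h6 := norm_sub_le (α • relResolvent L α (u - v)) (relResolvent L α w)
  linarith

theorem tendsto_yosida [CompleteSpace H] (hL : IsMaximalMonotone L) {u w : H}
    (h : (u, w) ∈ L) : Tendsto (fun α : ℝ => yosida L α u) atTop (𝓝 w) := by
  refine (hL.tendsto_smul_resolvent w).congr' ?_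
  filter_upwards [eventually_gt_atTop 0] with α hα
  rw [hL.yosida_apply hα h]

/-- For `v` in the domain, two exponentials differ by at most `t ‖yosida L α v - yosida L β v‖`,
which is small because the Yosida approximations converge there. Contractivity and density extend
this to all `u`. -/
theorem exists_tendsto_exp_yosida [CompleteSpace H] (hL : IsMaximalMonotone L) {t : ℝ}
    (ht : 0 ≤ t) (u : H) :
    ∃ v, Tendsto (fun α : ℝ => NormedSpace.exp (-(t • yosida L α)) u) atTop (𝓝 v) := by
  rw [← cauchy_map_iff_exists_tendsto, Metric.cauchy_iff]
  refine ⟨inferInstance, fun ε hε => ?_⟩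
  obtain ⟨v, ⟨w, hv⟩, hvu⟩ := hL.dense_fst.exists_dist_lt u (ε := ε / 3) (by positivity)
  have h1 := (hL.tendsto_yosida hv).cauchy_map
  obtain ⟨s, hs, hs'⟩ := (Metric.cauchy_iff.1 h1).2 (ε / (3 * (t + 1))) (by positivity)
  refine ⟨_, image_mem_map (inter_mem hs (Ioi_mem_atTop 0)), ?_⟩
  rintro _ ⟨α, ⟨hα, hα0⟩, rfl⟩ _ ⟨β, ⟨hβ, hβ0⟩, rfl⟩
  have h2 := hs' _ hα _ hβ
  have h3 := norm_exp_neg_smul_sub_le (hL.inner_yosida_nonneg hα0) (hL.inner_yosida_nonneg hβ0)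
    (hL.yosida_commute hα0 hβ0) ht v
  have h4 := norm_exp_neg_smul_apply_le (hL.inner_yosida_nonneg hα0) ht (u - v)
  have h5 := norm_exp_neg_smul_apply_le (hL.inner_yosida_nonneg hβ0) ht (u - v)
  rw [dist_eq_norm] at h2 hvu ⊢
  have h6 : t * ‖yosida L α v - yosida L β v‖ ≤ ε / 3 := by
    have h : ε / 3 = (t + 1) * (ε / (3 * (t + 1))) := by field_simp
    rw [h]
    exact mul_le_mul (by linarith) h2.le (norm_nonneg _) (by linarith)
  rw [map_sub] at h4 h5
  have h7 : ∀ a b c d : H, a - b = (a - c) - (b - d) + (c - d) := fun a b c d => by abel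
  rw [h7 _ _ (NormedSpace.exp (-(t • yosida L α)) v) (NormedSpace.exp (-(t • yosida L β)) v)]
  refine (norm_add_le _ _).trans_lt ?_
  have h8 := norm_sub_le (NormedSpace.exp (-(t • yosida L α)) u -
    NormedSpace.exp (-(t • yosida L α)) v) (NormedSpace.exp (-(t • yosida L β)) u -
    NormedSpace.exp (-(t • yosida L β)) v)
  linarith

theorem exists_limit_exp_yosida [CompleteSpace H] (hL : IsMaximalMonotone L) (t : ℝ≥0) :
    ∃ T : H →L[ℝ] H, ∀ u,
      Tendsto (fun α : ℝ => NormedSpace.exp (-((t : ℝ) • yosida L α)) u) atTop (𝓝 (T u)) := by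
  choose f hf using fun u => hL.exists_tendsto_exp_yosida t.2 u
  exact ⟨continuousLinearMapOfTendsto (fun α : ℝ => NormedSpace.exp (-((t : ℝ) • yosida L α)))
    (tendsto_pi_nhds.2 hf), hf⟩

/-- **Hille-Yosida theorem** for maximal monotone linear relations, with the semigroup obtained as
the limit of the semigroups of the Yosida approximations. -/
theorem exists_semigroup [CompleteSpace H] (hL : IsMaximalMonotone L) :
    ∃ T : ℝ≥0 → H →L[ℝ] H, IsSemigroupGeneratedByNeg (L : Set (H × H)) T ∧ ∀ (t : ℝ≥0) (u : H),
      Tendsto (fun α : ℝ => NormedSpace.exp (-((t : ℝ) • yosida L α)) u) atTop (𝓝 (T t u)) := by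
  choose T hT using hL.exists_limit_exp_yosida
  have hbd : ∀ t u, ‖T t u‖ ≤ ‖u‖ := fun t u => by
    refine le_of_tendsto (hT t u).norm ?_
    filter_upwards [eventually_gt_atTop 0] with α hα
    exact norm_exp_neg_smul_apply_le (hL.inner_yosida_nonneg hα) t.2 u
  have hdiff : ∀ (t : ℝ≥0) {u w : H}, (u, w) ∈ L → ∀ α : ℝ, 0 < α →
      ‖NormedSpace.exp (-((t : ℝ) • yosida L α)) u - T t u‖ ≤ (t : ℝ) * ‖yosida L α u - w‖ :=
    fun t u w hu α hα => by
      refine le_of_tendsto_of_tendsto (tendsto_const_nhds.sub (hT t u)).norm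
        ((tendsto_const_nhds.sub (hL.tendsto_yosida hu)).norm.const_mul (t : ℝ)) ?_
      filter_upwards [eventually_gt_atTop 0] with β hβ
      exact norm_exp_neg_smul_sub_le (hL.inner_yosida_nonneg hα) (hL.inner_yosida_nonneg hβ)
        (hL.yosida_commute hα hβ) t.2 u
  have hzero : T 0 = ContinuousLinearMap.id ℝ H := by
    ext u
    refine tendsto_nhds_unique (hT 0 u) ?_
    simp
  have hgen : ∀ {u w : H}, (u, w) ∈ L →
      Tendsto (fun t : ℝ≥0 => (t : ℝ)⁻¹ • (u - T t u)) (𝓝[>] 0) (𝓝 w) := fun {u w} hu => by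
    rw [Metric.tendsto_nhds]
    intro ε hε
    -- Fix one `α` with `yosida L α u` close to `w`. The difference quotients of `e^{-t yosida L α}`
    -- and of `T` then differ by at most `‖yosida L α u - w‖`, uniformly in `t`, so the limit of the
    -- former suffices.
    have h1 := (tendsto_iff_norm_sub_tendsto_zero.1 (hL.tendsto_yosida hu)).eventually
      (gt_mem_nhds (show (0 : ℝ) < ε / 3 by positivity))
    obtain ⟨α, hα, hα0⟩ := (h1.and (eventually_gt_atTop 0)).exists
    have hd : Tendsto (fun t : ℝ≥0 =>
        (t : ℝ)⁻¹ • (u - NormedSpace.exp (-((t : ℝ) • yosida L α)) u)) (𝓝[>] 0)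
        (𝓝 (yosida L α u)) := by
      have h := ((hasDerivAt_exp_smul_const' (𝕂 := ℝ) (-yosida L α) 0).clm_apply
        (hasDerivAt_const 0 u)).tendsto_slope_zero_right
      have hc : Tendsto (fun t : ℝ≥0 => (t : ℝ)) (𝓝[>] 0) (𝓝[>] 0) :=
        tendsto_nhdsWithin_iff.2 ⟨(NNReal.continuous_coe.tendsto 0).mono_left nhdsWithin_le_nhds, by
          filter_upwards [self_mem_nhdsWithin] with t ht
          exact NNReal.coe_pos.2 ht⟩
      have h' := (h.comp hc).neg
      simp only [zero_add, zero_smul, NormedSpace.exp_zero, mul_one, map_zero, add_zero,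
        neg_apply, neg_neg] at h'
      refine h'.congr fun t => ?_
      simp [← smul_neg]
    filter_upwards [(Metric.tendsto_nhds.1 hd) (ε / 3) (by positivity), self_mem_nhdsWithin]
      with t ht ht0
    have ht0' : (0 : ℝ) < t := NNReal.coe_pos.2 ht0
    have h2 := hdiff t hu α hα0
    have h3 : ‖(t : ℝ)⁻¹ • (NormedSpace.exp (-((t : ℝ) • yosida L α)) u - T t u)‖ < ε / 3 := by
      rw [norm_smul, norm_inv, Real.norm_of_nonneg ht0'.le, inv_mul_lt_iff₀ ht0']
      exact h2.trans_lt (mul_lt_mul_of_pos_left hα ht0')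
    rw [dist_eq_norm] at ht ⊢
    have h4 : (t : ℝ)⁻¹ • (u - T t u) - w =
        ((t : ℝ)⁻¹ • (u - NormedSpace.exp (-((t : ℝ) • yosida L α)) u) - yosida L α u) +
        (t : ℝ)⁻¹ • (NormedSpace.exp (-((t : ℝ) • yosida L α)) u - T t u) +
        (yosida L α u - w) := by
      simp only [smul_sub]; abel
    rw [h4]
    refine (norm_add₃_le).trans_lt ?_
    linarith
  refine ⟨T, ⟨hzero, fun s t => ?_, fun f => ?_, fun u w => ⟨hgen, fun h => ?_⟩⟩, hT⟩
  · ext u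
    have hd : Tendsto (fun α : ℝ => NormedSpace.exp (-((s : ℝ) • yosida L α))
        (NormedSpace.exp (-((t : ℝ) • yosida L α)) u)) atTop (𝓝 (T s (T t u))) := by
      rw [tendsto_iff_norm_sub_tendsto_zero]
      have h1 := (tendsto_iff_norm_sub_tendsto_zero.1 (hT t u)).add
        (tendsto_iff_norm_sub_tendsto_zero.1 (hT s (T t u)))
      rw [add_zero] at h1
      refine squeeze_zero' (Eventually.of_forall fun _ => norm_nonneg _) ?_ h1
      filter_upwards [eventually_gt_atTop 0] with α hα
      refine (norm_sub_le_norm_sub_add_norm_sub _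
        (NormedSpace.exp (-((s : ℝ) • yosida L α)) (T t u)) _).trans ?_
      gcongr
      rw [← map_sub]
      exact norm_exp_neg_smul_apply_le (hL.inner_yosida_nonneg hα) s.2 _
    refine tendsto_nhds_unique (hT (s + t) u) (hd.congr fun α => ?_)
    have hc : Commute (-((s : ℝ) • yosida L α)) (-((t : ℝ) • yosida L α)) :=
      (((Commute.refl _).smul_left _).smul_right _).neg_left.neg_right
    rw [← mul_apply_eq_comp, ← exp_add_of_commute_real hc]
    congr 2
    push_cast
    module
  · rw [Metric.tendsto_nhds]
    intro ε hε
    obtain ⟨v, ⟨w, hv⟩, hvu⟩ := hL.dense_fst.exists_dist_lt f (ε := ε / 3) (by positivity)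
    have h1 : Tendsto (fun t : ℝ≥0 => T t v) (𝓝 0) (𝓝 v) := by
      rw [tendsto_iff_norm_sub_tendsto_zero]
      have h2 : Tendsto (fun t : ℝ≥0 => (t : ℝ) * ‖w‖) (𝓝 0) (𝓝 0) := by
        have : Continuous fun t : ℝ≥0 => (t : ℝ) * ‖w‖ := by fun_prop
        simpa using this.tendsto 0
      refine squeeze_zero (fun _ => norm_nonneg _) (fun t => ?_) h2
      refine le_of_tendsto_of_tendsto ((hT t v).sub_const v).norm
        ((hL.tendsto_yosida hv).norm.const_mul (t : ℝ)) ?_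
      filter_upwards [eventually_gt_atTop 0] with α hα
      have := norm_exp_neg_smul_sub_le (hL.inner_yosida_nonneg hα) (B := 0) (by simp)
        (Commute.zero_right _) t.2 v
      simpa using this
    filter_upwards [Metric.tendsto_nhds.1 h1 (ε / 3) (by positivity)] with t ht
    have h2 := hbd t (f - v)
    rw [map_sub] at h2
    rw [dist_eq_norm] at ht hvu ⊢
    have h3 : T t f - f = (T t f - T t v) + (T t v - v) + (v - f) := by abel
    rw [h3]
    refine (norm_add₃_le).trans_lt ?_
    rw [norm_sub_rev v f]
    linarith
  -- The generator cannot be larger than `L`: by contractivity it is monotone, and since `1 + L` is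
  -- onto, some `(p, q) ∈ L` has `p + q = u + w`; monotonicity forces the two pairs to agree.
  · obtain ⟨p, q, hpq, he⟩ := hL.exists_add_eq 1 one_pos (u + w)
    have h1 := h.sub (hgen hpq)
    have h2 : 0 ≤ inner ℝ (w - q) (u - p) := by
      refine ge_of_tendsto (h1.inner (𝕜 := ℝ) tendsto_const_nhds) (Eventually.of_forall fun t => ?_)
      rw [← smul_sub, real_inner_smul_left]
      refine mul_nonneg (inv_nonneg.2 t.2) ?_
      have h3 : u - T t u - (p - T t p) = (u - p) - T t (u - p) := by rw [map_sub]; abel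
      rw [h3, inner_sub_left, real_inner_self_eq_norm_mul_norm]
      refine sub_nonneg.2 ((real_inner_le_norm _ _).trans ?_)
      gcongr
      exact hbd _ _
    rw [one_smul] at he
    have h3 : w - q = -(u - p) := by
      rw [eq_neg_iff_add_eq_zero, ← sub_eq_zero.2 he.symm]; abel
    rw [h3, inner_neg_left, real_inner_self_eq_norm_sq] at h2
    have h4 : u - p = 0 := by
      rw [← norm_eq_zero]
      exact pow_eq_zero_iff two_ne_zero |>.1 (by nlinarith [sq_nonneg ‖u - p‖])
    rw [h4, neg_zero] at h3
    rw [sub_eq_zero.1 h4, sub_eq_zero.1 h3]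
    exact hpq

/-! ### Invariant cones and the Laplace transform. -/

/-- The approximating semigroup factors as `e^{-tα} e^{tα² R_α}`, a power series in `R_α` with
nonnegative coefficients, so it maps the closed cone to itself; the limit `α → ∞` keeps this. -/
theorem semigroup_mem_of_resolvent_mem [CompleteSpace H] (hL : IsMaximalMonotone L)
    {T : ℝ≥0 → H →L[ℝ] H} (hT : IsSemigroupGeneratedByNeg (L : Set (H × H)) T)
    {C : Submodule ℝ≥0 H} (hC : IsClosed (C : Set H))
    (hR : ∀ α : ℝ, 0 < α → ∀ f ∈ C, relResolvent L α f ∈ C) (t : ℝ≥0) {f : H} (hf : f ∈ C) :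
    T t f ∈ C := by
  have hsm : ∀ c : ℝ, 0 ≤ c → ∀ g ∈ C, c • g ∈ C := fun c hc g hg => C.smul_mem ⟨c, hc⟩ hg
  obtain ⟨S, hS, hlim⟩ := hL.exists_semigroup
  rw [hL.semigroup_unique hT hS]
  refine hC.mem_of_tendsto (hlim t f) ?_
  filter_upwards [eventually_gt_atTop 0] with α hα
  have h1 : -((t : ℝ) • yosida L α) =
      (-(t * α)) • (1 : H →L[ℝ] H) + (t * α ^ 2) • relResolvent L α := by
    rw [yosida]; module
  have hcomm : Commute ((-(t * α)) • (1 : H →L[ℝ] H)) ((t * α ^ 2) • relResolvent L α) :=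
    (Commute.one_left _).smul_left _
  have h2 : NormedSpace.exp ((-(t * α)) • (1 : H →L[ℝ] H)) =
      Real.exp (-(t * α)) • (1 : H →L[ℝ] H) := by
    rw [← Algebra.algebraMap_eq_smul_one, ← Algebra.algebraMap_eq_smul_one,
      Real.exp_eq_exp_ℝ, NormedSpace.algebraMap_exp_comm]
  rw [h1, exp_add_of_commute_real hcomm, h2, smul_mul_assoc, one_mul]
  refine hsm _ (Real.exp_pos _).le _ ?_
  have h3 := (NormedSpace.exp_series_hasSum_exp' (𝕂 := ℝ)
    ((t * α ^ 2) • relResolvent L α)).mapL (ContinuousLinearMap.apply ℝ H f)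
  refine hC.mem_of_tendsto h3 (Eventually.of_forall fun s => C.sum_mem fun n _ => ?_)
  have h4 : ∀ n : ℕ, (((t * α ^ 2) • relResolvent L α) ^ n) f ∈ C := fun n => by
    induction n with
    | zero => simpa using hf
    | succ n ih =>
      rw [pow_succ', mul_apply_eq_comp]
      exact hsm _ (by positivity) _ (hR α hα _ ih)
  exact hsm _ (by positivity) _ (h4 n)

theorem integrableOn_exp_mul_semigroup [CompleteSpace H] (hL : IsMaximalMonotone L)
    {T : ℝ≥0 → H →L[ℝ] H} (hT : IsSemigroupGeneratedByNeg (L : Set (H × H)) T) {α : ℝ} (hα : 0 < α)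
    (l : H →L[ℝ] ℝ) (f : H) :
    IntegrableOn (fun t : ℝ => Real.exp (-α * t) * l (T t.toNNReal f)) (Ioi 0) := by
  refine (exp_neg_integrableOn_Ioi 0 hα).mul_bdd (c := ‖l‖ * ‖f‖)
    (l.continuous.comp (hT.continuous_orbit_real f)).aestronglyMeasurable
    (Eventually.of_forall fun t => ?_)
  exact (l.le_opNorm _).trans (by gcongr; exact hL.norm_semigroup_apply_le hT _ _)

/-- The resolvent is the Laplace transform of the semigroup. -/
theorem integral_exp_mul_semigroup [CompleteSpace H] (hL : IsMaximalMonotone L)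
    {T : ℝ≥0 → H →L[ℝ] H} (hT : IsSemigroupGeneratedByNeg (L : Set (H × H)) T) {α : ℝ} (hα : 0 < α)
    (l : H →L[ℝ] ℝ) (f : H) :
    ∫ t in Ioi (0 : ℝ), Real.exp (-α * t) * l (T t.toNNReal f) = l (relResolvent L α f) := by
  have hint := hL.integrableOn_exp_mul_semigroup hT hα l f
  have hu := hL.resolvent_mem hα f
  set u := relResolvent L α f with hu_def
  have hcont : Continuous fun t : ℝ => Real.exp (-α * t) * l (T t.toNNReal u) :=
    (by fun_prop : Continuous fun t : ℝ => Real.exp (-α * t)).mul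
      (l.continuous.comp (hT.continuous_orbit_real u))
  -- With `u = R_α f` and `L u = f - α u`, the two terms containing `α T_t u` cancel, so `-e^{-αt}
  -- l(T_t u)` is a primitive of the integrand.
  have hderiv : ∀ t : ℝ, 0 ≤ t →
      HasDerivWithinAt (fun t : ℝ => Real.exp (-α * t) * l (T t.toNNReal u))
        (-(Real.exp (-α * t) * l (T t.toNNReal f))) (Ici t) t := fun t ht => by
    have h1 : HasDerivAt (fun t : ℝ => Real.exp (-α * t)) (Real.exp (-α * t) * -α) t := by
      simpa using ((hasDerivAt_id t).const_mul (-α)).exp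
    have h2 := (l.hasFDerivAt (x := T t.toNNReal u)).comp_hasDerivWithinAt t
      (hT.hasDerivWithinAt hu ht)
    refine (h1.hasDerivWithinAt.mul h2).congr_deriv ?_
    simp only [Function.comp_apply, map_neg, map_sub, map_smul, smul_eq_mul]
    ring
  have hftc : ∀ b : ℝ, 0 ≤ b → ∫ t in (0 : ℝ)..b, Real.exp (-α * t) * l (T t.toNNReal f) =
      l u - Real.exp (-α * b) * l (T b.toNNReal u) := fun b hb => by
    have h := intervalIntegral.integral_eq_sub_of_hasDeriv_right_of_le hb hcont.continuousOn
      (fun t ht => (hderiv t ht.1.le).mono Ioi_subset_Ici_self)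
      ((intervalIntegrable_iff_integrableOn_Ioc_of_le hb).2
        (hint.mono_set Ioc_subset_Ioi_self)).neg
    rw [intervalIntegral.integral_neg] at h
    simp only [mul_zero, Real.exp_zero, Real.toNNReal_zero, hT.apply_zero, one_mul] at h
    linarith
  refine tendsto_nhds_unique (intervalIntegral_tendsto_integral_Ioi 0 hint tendsto_id) ?_
  have hdecay : Tendsto (fun b : ℝ => Real.exp (-α * b) * l (T b.toNNReal u)) atTop (𝓝 0) := by
    have h1 : Tendsto (fun b : ℝ => Real.exp (-α * b) * (‖l‖ * ‖u‖)) atTop (𝓝 0) := by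
      have h2 : Tendsto (fun b : ℝ => Real.exp (-α * b)) atTop (𝓝 0) :=
        Real.tendsto_exp_atBot.comp
          ((tendsto_const_mul_atBot_of_neg (neg_lt_zero.2 hα)).2 tendsto_id)
      simpa using h2.mul_const (‖l‖ * ‖u‖)
    refine squeeze_zero_norm (fun b => ?_) h1
    rw [norm_mul, Real.norm_of_nonneg (Real.exp_pos _).le]
    gcongr
    exact (l.le_opNorm _).trans (by gcongr; exact hL.norm_semigroup_apply_le hT _ _)
  have h := (tendsto_const_nhds (x := l u)).sub hdecay
  rw [sub_zero] at h
  refine h.congr' ?_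
  filter_upwards [eventually_ge_atTop 0] with b hb
  exact (hftc b hb).symm

end IsMaximalMonotone

/-! ### Operators associated with closed forms. -/

/-- The operator associated with the form `⟪k, l⟫` for `(u, k), (v, l) ∈ M`, where `M` is the graph of
a (closed) operator between Hilbert spaces. -/
def formRelation {H K : Type*} [NormedAddCommGroup H] [InnerProductSpace ℝ H]
    [NormedAddCommGroup K] [InnerProductSpace ℝ K] (M : Submodule ℝ (WithLp 2 (H × K))) :
    Submodule ℝ (H × H) where
  carrier := {p | ∃ k : K, WithLp.toLp 2 (p.1, k) ∈ M ∧
    ∀ q ∈ M, inner ℝ k q.snd = inner ℝ p.2 q.fst}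
  add_mem' := by
    rintro ⟨u, w⟩ ⟨u', w'⟩ ⟨k, hk, h⟩ ⟨k', hk', h'⟩
    exact ⟨k + k', M.add_mem hk hk', fun q hq => by
      simp only [Prod.mk_add_mk, inner_add_left, h q hq, h' q hq]⟩
  zero_mem' := ⟨0, M.zero_mem, fun q _ => by simp⟩
  smul_mem' := by
    rintro c ⟨u, w⟩ ⟨k, hk, h⟩
    exact ⟨c • k, M.smul_mem c hk, fun q hq => by
      simp only [Prod.smul_mk, real_inner_smul_left, h q hq]⟩

theorem isMaximalMonotone_formRelation {H K : Type*} [NormedAddCommGroup H]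
    [InnerProductSpace ℝ H] [CompleteSpace H] [NormedAddCommGroup K] [InnerProductSpace ℝ K]
    [CompleteSpace K] {M : Submodule ℝ (WithLp 2 (H × K))}
    (hM : IsClosed (M : Set (WithLp 2 (H × K))))
    (hd : Dense (WithLp.fst '' (M : Set (WithLp 2 (H × K))))) :
    IsMaximalMonotone (formRelation M) := by
  refine ⟨?_, fun α hα f => ?_, ?_⟩
  · rintro u w ⟨k, hk, h⟩
    exact (real_inner_self_nonneg (x := k)).trans_eq (h _ hk)
  -- Rescaling the second component by `√α` turns `α ⟪u, v⟫ + ⟪k, l⟫` into `α` times the product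
  -- inner product. The weak equation then says that the solution is the projection of `(α⁻¹ f, 0)`
  -- onto a closed subspace.
  · have hs := Real.sqrt_pos.2 hα
    set s := √α with hs_def
    have hss : s * s = α := Real.mul_self_sqrt hα.le
    let S : WithLp 2 (H × K) →ₗ[ℝ] WithLp 2 (H × K) :=
      { toFun := fun q => WithLp.toLp 2 (q.fst, s • q.snd)
        map_add' := fun q r => by simp [← WithLp.toLp_add]
        map_smul' := fun c q => by simp [← WithLp.toLp_smul, smul_comm s c] }
    have hS : Continuous S :=
      (WithLp.prod_continuous_toLp 2 H K).comp
        ((WithLp.continuous_fst 2 H K).prodMk ((WithLp.continuous_snd 2 H K).const_smul s))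
    have hN : IsClosed ((M.comap S : Submodule ℝ (WithLp 2 (H × K))) : Set (WithLp 2 (H × K))) :=
      hM.preimage hS
    have := hN.completeSpace_coe
    have hp := (M.comap S).starProjection_apply_mem (WithLp.toLp 2 (α⁻¹ • f, (0 : K)))
    have hp' := fun q hq => (M.comap S).starProjection_inner_eq_zero
      (WithLp.toLp 2 (α⁻¹ • f, (0 : K))) q hq
    set p := (M.comap S).starProjection (WithLp.toLp 2 (α⁻¹ • f, (0 : K)))
    refine ⟨p.fst, f - α • p.fst, ⟨s • p.snd, hp, fun q hq => ?_⟩, by simp⟩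
    have h1 := hp' (WithLp.toLp 2 (q.fst, s⁻¹ • q.snd)) (by
      change WithLp.toLp 2 (q.fst, s • s⁻¹ • q.snd) ∈ M
      rw [smul_inv_smul₀ hs.ne']
      exact hq)
    rw [WithLp.prod_inner_apply] at h1
    simp only [WithLp.ofLp_sub, Prod.fst_sub, Prod.snd_sub, inner_sub_left, real_inner_smul_left,
      real_inner_smul_right, zero_sub, inner_neg_left] at h1
    simp only [inner_sub_left, real_inner_smul_left]
    change α⁻¹ * inner ℝ f q.fst - inner ℝ p.fst q.fst + -(s⁻¹ * inner ℝ p.snd q.snd) = 0 at h1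
    have h2 : s * (inner ℝ p.snd q.snd) = α * (s⁻¹ * inner ℝ p.snd q.snd) := by
      rw [← hss]; field_simp
    rw [h2]
    have h3 : inner ℝ f q.fst = α * (α⁻¹ * inner ℝ f q.fst) := by field_simp
    rw [h3]
    linear_combination (-α) * h1
  · rintro w ⟨k, hk, h⟩
    have hk0 : k = 0 := by
      have h1 : inner ℝ k k = inner ℝ w (0 : H) := h _ hk
      rw [inner_zero_right] at h1
      exact inner_self_eq_zero.1 h1
    refine hd.eq_zero_of_inner_left ℝ ?_
    rintro _ ⟨q, hq, rfl⟩
    rw [← h q hq, hk0, inner_zero_left]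

/-! ### The Dirichlet form as a closed gradient. -/

namespace WeightedGraph

variable {V : Type*} (G : WeightedGraph V)

/-- The graph of the gradient `u ↦ (b(x, y) / 2)^{1/2} (u x - u y)` on its maximal domain. -/
def gradGraph : Submodule ℝ (WithLp 2 (EllTwo V × EllTwo (V × V))) where
  carrier := {q | ∀ p : V × V, (q.snd : V × V → ℝ) p =
    √((G.b p.1 p.2 : ℝ) / 2) * ((q.fst : V → ℝ) p.1 - (q.fst : V → ℝ) p.2)}
  add_mem' := by
    intro q r hq hr p
    simp only [WithLp.add_fst, WithLp.add_snd, lp.coeFn_add, Pi.add_apply, hq p, hr p]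
    ring
  zero_mem' := fun p => by simp
  smul_mem' := by
    intro c q hq p
    simp only [WithLp.smul_fst, WithLp.smul_snd, lp.coeFn_smul, Pi.smul_apply, hq p, smul_eq_mul]
    ring

/-- The graph of the gradient on finitely supported functions. -/
def gradGraphFin : Submodule ℝ (WithLp 2 (EllTwo V × EllTwo (V × V))) where
  carrier := {q | q ∈ G.gradGraph ∧ (Function.support (q.fst : V → ℝ)).Finite}
  add_mem' := fun hq hr => ⟨G.gradGraph.add_mem hq.1 hr.1,
    (hq.2.union hr.2).subset (Function.support_add _ _)⟩
  zero_mem' := ⟨G.gradGraph.zero_mem, finite_empty.subset fun _ h => h rfl⟩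
  smul_mem' := fun c q hq => ⟨G.gradGraph.smul_mem c hq.1,
    hq.2.subset (Function.support_const_smul_subset c (q.fst : V → ℝ))⟩

/-- The graph of the closure of the gradient on finitely supported functions. -/
def gradGraphMin : Submodule ℝ (WithLp 2 (EllTwo V × EllTwo (V × V))) :=
  G.gradGraphFin.topologicalClosure

theorem continuous_ellTwo_apply {V : Type*} (x : V) :
    Continuous fun u : EllTwo V => (u : V → ℝ) x :=
  (lp.evalCLM ℝ (fun _ : V => ℝ) (p := 2) x).continuous

theorem isClosed_gradGraph :
    IsClosed (G.gradGraph : Set (WithLp 2 (EllTwo V × EllTwo (V × V)))) := by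
  have : (G.gradGraph : Set (WithLp 2 (EllTwo V × EllTwo (V × V)))) = ⋂ p : V × V,
      {q | (q.snd : V × V → ℝ) p =
        √((G.b p.1 p.2 : ℝ) / 2) * ((q.fst : V → ℝ) p.1 - (q.fst : V → ℝ) p.2)} := by
    ext q
    simp [gradGraph]
  rw [this]
  refine isClosed_iInter fun p => isClosed_eq ?_ ?_
  · exact (continuous_ellTwo_apply p).comp (WithLp.continuous_snd 2 _ _)
  · exact (((continuous_ellTwo_apply p.1).comp (WithLp.continuous_fst 2 _ _)).sub
      ((continuous_ellTwo_apply p.2).comp (WithLp.continuous_fst 2 _ _))).const_mul _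

theorem gradGraphMin_le : G.gradGraphMin ≤ G.gradGraph :=
  Submodule.topologicalClosure_minimal _ (fun _ h => h.1) G.isClosed_gradGraph

variable {G}

theorem inner_snd_eq_form {q r : WithLp 2 (EllTwo V × EllTwo (V × V))} (hq : q ∈ G.gradGraph)
    (hr : r ∈ G.gradGraph) : inner ℝ q.snd r.snd = G.form q.fst r.fst := by
  rw [lp.inner_eq_tsum, form, ← tsum_mul_left]
  refine tsum_congr fun p => ?_
  rw [hq p, hr p]
  have h := Real.mul_self_sqrt (show 0 ≤ (G.b p.1 p.2 : ℝ) / 2 by positivity)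
  simp only [RCLike.inner_apply, conj_trivial]
  linear_combination ((q.fst : V → ℝ) p.1 - (q.fst : V → ℝ) p.2) *
    ((r.fst : V → ℝ) p.1 - (r.fst : V → ℝ) p.2) * h

theorem energy_eq_tsum (u : V → ℝ) : G.energy u = ∑' p : V × V, ENNReal.ofReal
    ((√((G.b p.1 p.2 : ℝ) / 2) * (u p.1 - u p.2)) ^ 2) := by
  rw [energy, ← ENNReal.tsum_mul_left]
  refine tsum_congr fun p => ?_
  rw [mul_pow, Real.sq_sqrt (by positivity), ENNReal.ofReal_mul (by positivity), ← mul_assoc,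
    div_eq_mul_inv (G.b p.1 p.2 : ℝ), mul_comm (G.b p.1 p.2 : ℝ), ENNReal.ofReal_mul (by norm_num),
    ENNReal.ofReal_inv_of_pos (by norm_num), ENNReal.ofReal_coe_nnreal]
  simp

theorem energy_fst_eq {q : WithLp 2 (EllTwo V × EllTwo (V × V))} (hq : q ∈ G.gradGraph) :
    G.energy q.fst = ENNReal.ofReal (‖q.snd‖ ^ 2) := by
  rw [energy_eq_tsum, ← real_inner_self_eq_norm_sq, lp.inner_eq_tsum]
  have h : ∀ p, inner ℝ ((q.snd : V × V → ℝ) p) ((q.snd : V × V → ℝ) p) =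
      (√((G.b p.1 p.2 : ℝ) / 2) * ((q.fst : V → ℝ) p.1 - (q.fst : V → ℝ) p.2)) ^ 2 := fun p => by
    rw [hq p, real_inner_self_eq_norm_sq, Real.norm_eq_abs, sq_abs]
  have hs := lp.summable_inner (𝕜 := ℝ) q.snd q.snd
  simp only [h] at hs ⊢
  rw [ENNReal.ofReal_tsum_of_nonneg (fun p => sq_nonneg _) hs]

theorem exists_mem_gradGraph {u : EllTwo V} (hu : G.energy u < ∞) :
    ∃ k, WithLp.toLp 2 (u, k) ∈ G.gradGraph := by
  have hmem : Memℓp (fun p : V × V => √((G.b p.1 p.2 : ℝ) / 2) *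
      ((u : V → ℝ) p.1 - (u : V → ℝ) p.2)) 2 := by
    refine memℓp_gen ?_
    rw [energy_eq_tsum] at hu
    have h := ENNReal.summable_toReal hu.ne
    refine h.congr fun p => ?_
    rw [ENNReal.toReal_ofReal (sq_nonneg _), Real.norm_eq_abs, ENNReal.toReal_ofNat,
      Real.rpow_two, sq_abs]
  exact ⟨⟨_, hmem⟩, fun p => rfl⟩

/-- Energy is the squared norm of the gradient, so the form norm is the graph norm; closing in the
one is closing in the other. -/
theorem mem_formDomain_iff {u : EllTwo V} :
    u ∈ G.formDomain ↔ ∃ k, WithLp.toLp 2 (u, k) ∈ G.gradGraphMin := by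
  constructor
  · rintro ⟨hu, happ⟩
    obtain ⟨k, hk⟩ := exists_mem_gradGraph hu
    refine ⟨k, ?_⟩
    change _ ∈ closure _
    rw [Metric.mem_closure_iff]
    intro ε hε
    obtain ⟨φ, hφ, hlt⟩ := happ (ENNReal.ofReal (ε ^ 2)) (by positivity)
    obtain ⟨l, hl⟩ := exists_mem_gradGraph (G := G) (u := u - φ)
      (lt_of_le_of_lt le_self_add (hlt.trans ENNReal.ofReal_lt_top))
    refine ⟨WithLp.toLp 2 (u, k) - WithLp.toLp 2 (u - φ, l),
      ⟨G.gradGraph.sub_mem hk hl, ?_⟩, ?_⟩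
    · rw [WithLp.sub_fst]
      simpa using hφ
    · rw [dist_eq_norm, sub_sub_cancel]
      have he := energy_fst_eq hl
      simp only [WithLp.toLp_fst, WithLp.toLp_snd] at he
      rw [he, ← ENNReal.ofReal_add (sq_nonneg _) (sq_nonneg _),
        ENNReal.ofReal_lt_ofReal_iff (by positivity)] at hlt
      have h2 := WithLp.prod_norm_sq_eq_of_L2 (WithLp.toLp 2 (u - φ, l))
      simp only [WithLp.toLp_fst, WithLp.toLp_snd] at h2
      exact lt_of_pow_lt_pow_left₀ 2 hε.le (by linarith)
  · rintro ⟨k, hk⟩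
    refine ⟨?_, fun ε hε => ?_⟩
    · have := energy_fst_eq (G.gradGraphMin_le hk)
      simp only [WithLp.toLp_fst] at this
      rw [this]
      exact ENNReal.ofReal_lt_top
    · obtain ⟨δ, hδ, hδε⟩ : ∃ δ : ℝ, 0 < δ ∧ ENNReal.ofReal (δ ^ 2) ≤ ε := by
        rcases eq_or_ne ε ∞ with rfl | htop
        · exact ⟨1, one_pos, le_top⟩
        · refine ⟨√ε.toReal, Real.sqrt_pos.2 (ENNReal.toReal_pos hε.ne' htop), ?_⟩
          rw [Real.sq_sqrt ENNReal.toReal_nonneg, ENNReal.ofReal_toReal htop]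
      change _ ∈ closure _ at hk
      obtain ⟨q, hq, hlt⟩ := Metric.mem_closure_iff.1 hk δ hδ
      refine ⟨q.fst, hq.2, lt_of_lt_of_le ?_ hδε⟩
      have hd := G.gradGraph.sub_mem (G.gradGraphMin_le hk) hq.1
      have he := energy_fst_eq hd
      rw [WithLp.sub_fst, WithLp.toLp_fst] at he
      rw [he, ← ENNReal.ofReal_add (sq_nonneg _) (sq_nonneg _),
        ENNReal.ofReal_lt_ofReal_iff (by positivity)]
      have h2 := WithLp.prod_norm_sq_eq_of_L2 (WithLp.toLp 2 (u, k) - q)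
      rw [WithLp.sub_fst, WithLp.toLp_fst] at h2
      rw [add_comm, ← h2]
      rw [dist_eq_norm] at hlt
      gcongr

theorem dirichletOperator_eq :
    G.dirichletOperator = (formRelation G.gradGraphMin : Set (EllTwo V × EllTwo V)) := by
  ext ⟨u, w⟩
  constructor
  · rintro ⟨hu, h⟩
    obtain ⟨k, hk⟩ := mem_formDomain_iff.1 hu
    refine ⟨k, hk, fun q hq => ?_⟩
    have h1 := inner_snd_eq_form (G.gradGraphMin_le hk) (G.gradGraphMin_le hq)
    simp only [WithLp.toLp_snd, WithLp.toLp_fst] at h1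
    rw [h1]
    exact h _ (mem_formDomain_iff.2 ⟨q.snd, hq⟩)
  · rintro ⟨k, hk, h⟩
    refine ⟨mem_formDomain_iff.2 ⟨k, hk⟩, fun v hv => ?_⟩
    obtain ⟨l, hl⟩ := mem_formDomain_iff.1 hv
    have h1 := inner_snd_eq_form (G.gradGraphMin_le hk) (G.gradGraphMin_le hl)
    simp only [WithLp.toLp_snd, WithLp.toLp_fst] at h1
    rw [← h1]
    exact h _ hl

theorem hasSum_deg (x : V) : HasSum (fun y => (G.b x y : ℝ)) (G.deg x) :=
  NNReal.hasSum_coe.2 (G.b_summable x).hasSum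

/-- Multiplying the weights by a finitely supported function of the first vertex yields a summable
family. -/
theorem summable_b_mul {ψ : V → ℝ} (hψ : (Function.support ψ).Finite) :
    Summable fun p : V × V => (G.b p.1 p.2 : ℝ) * ψ p.1 := by
  refine Summable.of_norm ?_
  simp only [norm_mul]
  refine (summable_prod_of_nonneg fun p => by positivity).2 ⟨fun x => ?_, ?_⟩
  · simpa using (hasSum_deg (G := G) x).summable.mul_right ‖ψ x‖
  · refine summable_of_hasFiniteSupport (hψ.subset fun x hx => ?_)
    contrapose! hx
    simp only [Function.notMem_support] at hx ⊢
    simp [hx]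

theorem summable_b_mul' {ψ : V → ℝ} (hψ : (Function.support ψ).Finite) :
    Summable fun p : V × V => (G.b p.1 p.2 : ℝ) * ψ p.2 := by
  refine ((Equiv.prodComm V V).summable_iff.2 (summable_b_mul (G := G) hψ)).congr fun p => ?_
  simp [G.b_symm p.1 p.2]

theorem energy_lt_top_of_finite_support {ψ : V → ℝ} (hψ : (Function.support ψ).Finite) :
    G.energy ψ < ∞ := by
  have hψ2 : (Function.support fun x => ψ x ^ 2).Finite := by
    refine hψ.subset fun x hx => ?_
    contrapose! hx
    simp only [Function.notMem_support] at hx ⊢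
    simp [hx]
  have hs := (summable_b_mul (G := G) hψ2).add (summable_b_mul' (G := G) hψ2)
  rw [energy_eq_tsum, lt_top_iff_ne_top]
  refine ne_top_of_le_ne_top hs.tsum_ofReal_ne_top (ENNReal.tsum_le_tsum fun p => ?_)
  refine ENNReal.ofReal_le_ofReal ?_
  rw [mul_pow, Real.sq_sqrt (by positivity)]
  have hb : 0 ≤ (G.b p.1 p.2 : ℝ) := by positivity
  -- The gap between the two sides is `b/2 · (ψ p.1 + ψ p.2)²`.
  nlinarith [mul_nonneg hb (sq_nonneg (ψ p.1 + ψ p.2))]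

theorem mem_formDomain_of_finite_support {ψ : EllTwo V}
    (hψ : (Function.support (ψ : V → ℝ)).Finite) : ψ ∈ G.formDomain :=
  ⟨energy_lt_top_of_finite_support hψ, fun ε hε => ⟨ψ, hψ, by simpa [energy] using hε⟩⟩

open Classical in
theorem delta_apply (x y : V) : (delta x : V → ℝ) y = if y = x then 1 else 0 := by
  rw [delta, lp.single_apply, Pi.single_apply]

theorem finite_support_delta (x : V) : (Function.support (delta x : V → ℝ)).Finite := by
  classical
  refine (finite_singleton x).subset fun y hy => ?_
  rw [Function.mem_support, delta_apply] at hy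
  simpa using hy

theorem inner_delta (x : V) (u : EllTwo V) : inner ℝ u (delta x) = (u : V → ℝ) x := by
  classical
  rw [delta, lp.inner_single_right]
  simp

theorem isMaximalMonotone : IsMaximalMonotone (formRelation G.gradGraphMin) := by
  refine isMaximalMonotone_formRelation (Submodule.isClosed_topologicalClosure _) ?_
  have h : (G.gradGraphMin.map (WithLp.fstₗ 2 ℝ (EllTwo V) (EllTwo (V × V)))).topologicalClosure
      = ⊤ := by
    rw [Submodule.topologicalClosure_eq_top_iff, Submodule.eq_bot_iff]
    intro u hu
    rw [Submodule.mem_orthogonal'] at hu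
    ext x
    obtain ⟨k, hk⟩ := mem_formDomain_iff.1
      (mem_formDomain_of_finite_support (G := G) (finite_support_delta x))
    have := hu _ ⟨_, hk, rfl⟩
    simpa [inner_delta] using this
  exact Submodule.dense_iff_topologicalClosure_eq_top.2 h

end WeightedGraph

/-! ### The formal Laplacian and the domination principle. -/

theorem abs_ellTwo_apply_le {V : Type*} (u : EllTwo V) (x : V) : |(u : V → ℝ) x| ≤ ‖u‖ :=
  lp.norm_apply_le_norm two_ne_zero u x

namespace WeightedGraph

variable {V : Type*} (G : WeightedGraph V)

/-- The formal Laplacian `∑_y b(x, y) (u x - u y)`. -/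
def lap (u : V → ℝ) (x : V) : ℝ := ∑' y, (G.b x y : ℝ) * (u x - u y)

variable {G}

theorem summable_b_mul_of_bounded {g : V → ℝ} {C : ℝ} (hg : ∀ x, |g x| ≤ C) (x : V) :
    Summable fun y => (G.b x y : ℝ) * g y := by
  refine Summable.of_norm_bounded ((hasSum_deg (G := G) x).summable.mul_right C) fun y => ?_
  rw [norm_mul, Real.norm_of_nonneg (by positivity)]
  gcongr
  exact hg y

theorem lap_eq {g : V → ℝ} {C : ℝ} (hg : ∀ x, |g x| ≤ C) (x : V) :
    G.lap g x = G.deg x * g x - ∑' y, (G.b x y : ℝ) * g y := by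
  simp only [lap, mul_sub]
  exact (((hasSum_deg (G := G) x).mul_right (g x)).sub
    (summable_b_mul_of_bounded hg x).hasSum).tsum_eq

theorem lap_sub {g h : V → ℝ} {C D : ℝ} (hg : ∀ x, |g x| ≤ C) (hh : ∀ x, |h x| ≤ D) (x : V) :
    G.lap (fun x => g x - h x) x = G.lap g x - G.lap h x := by
  have hgh : ∀ x, |g x - h x| ≤ C + D := fun x =>
    (abs_sub _ _).trans (add_le_add (hg x) (hh x))
  rw [lap_eq hgh, lap_eq hg, lap_eq hh]
  simp only [mul_sub]
  rw [(summable_b_mul_of_bounded hg x).tsum_sub (summable_b_mul_of_bounded hh x)]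
  ring

theorem summable_form_aux {g ψ : V → ℝ} {C : ℝ} (hg : ∀ x, |g x| ≤ C)
    (hψ : (Function.support ψ).Finite) :
    Summable fun p : V × V => (G.b p.1 p.2 : ℝ) * (g p.1 - g p.2) * ψ p.1 := by
  have hs : Summable fun p : V × V => (G.b p.1 p.2 : ℝ) * (2 * C * |ψ p.1|) := by
    refine summable_b_mul (ψ := fun x => 2 * C * |ψ x|) (hψ.subset fun x hx => ?_)
    contrapose! hx
    simp only [Function.notMem_support] at hx ⊢
    simp [hx]
  refine Summable.of_norm_bounded hs fun p => ?_
  rw [norm_mul, norm_mul, Real.norm_of_nonneg (by positivity), mul_assoc, Real.norm_eq_abs,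
    Real.norm_eq_abs]
  gcongr
  have := abs_sub (g p.1) (g p.2)
  linarith [hg p.1, hg p.2]

theorem summable_form {g ψ : V → ℝ} {C : ℝ} (hg : ∀ x, |g x| ≤ C)
    (hψ : (Function.support ψ).Finite) :
    Summable fun p : V × V => (G.b p.1 p.2 : ℝ) * ((g p.1 - g p.2) * (ψ p.1 - ψ p.2)) := by
  have h1 := summable_form_aux (G := G) hg hψ
  have h2 := (Equiv.prodComm V V).summable_iff.2 h1
  refine (h1.add h2).congr fun p => ?_
  simp only [Function.comp_apply, Equiv.prodComm_apply, Prod.fst_swap, Prod.snd_swap,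
    G.b_symm p.2 p.1]
  ring

/-- Green's formula for a bounded function and a finitely supported one. -/
theorem hasSum_form {g ψ : V → ℝ} {C : ℝ} (hg : ∀ x, |g x| ≤ C)
    (hψ : (Function.support ψ).Finite) : HasSum (fun x => G.lap g x * ψ x) (G.form g ψ) := by
  have h1 := summable_form_aux (G := G) hg hψ
  have h2 : HasSum (fun p : V × V => (G.b p.1 p.2 : ℝ) * ((g p.1 - g p.2) * (ψ p.1 - ψ p.2)))
      (2 * ∑' p : V × V, (G.b p.1 p.2 : ℝ) * (g p.1 - g p.2) * ψ p.1) := by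
    have h3 := (Equiv.prodComm V V).hasSum_iff.2 h1.hasSum
    have h4 := h1.hasSum.add h3
    rw [← two_mul] at h4
    refine h4.congr_fun fun p => ?_
    simp only [Function.comp_apply, Equiv.prodComm_apply, Prod.fst_swap, Prod.snd_swap,
      G.b_symm p.2 p.1]
    ring
  have h5 : G.form g ψ = ∑' p : V × V, (G.b p.1 p.2 : ℝ) * (g p.1 - g p.2) * ψ p.1 := by
    rw [form, h2.tsum_eq]; ring
  rw [h5]
  refine (h1.hasSum.prod_fiberwise fun x => (h1.prod_factor x).hasSum).congr_fun fun x => ?_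
  rw [lap, ← tsum_mul_right]

/-- Test the weak equation with `δ_x` and apply Green's formula, available because `ℓ²` functions
are bounded. -/
theorem lap_eq_of_mem {u w : EllTwo V} (h : (u, w) ∈ formRelation G.gradGraphMin) (x : V) :
    G.lap u x = (w : V → ℝ) x := by
  classical
  obtain ⟨hu, hform⟩ := (dirichletOperator_eq (G := G)).ge h
  have h1 := hform _ (mem_formDomain_of_finite_support (finite_support_delta x))
  have h2 := hasSum_form (G := G) (abs_ellTwo_apply_le u) (finite_support_delta x)
  rw [h1, inner_delta] at h2
  refine HasSum.unique ?_ h2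
  convert hasSum_single x fun y hy => ?_ using 1
  · simp [delta_apply]
  · simp [delta_apply, hy]

theorem sub_max_mul_ge (a b : ℝ) :
    (max a 0 - max b 0) * (max a 0 - max b 0) ≤ (a - b) * (max a 0 - max b 0) := by
  rcases le_total a 0 with ha | ha <;> rcases le_total b 0 with hb | hb <;>
    simp only [max_eq_left, max_eq_right, ha, hb] <;> nlinarith

/-- Edge by edge this is the Markov property of the positive part, `sub_max_mul_ge`, applied to `d -
e`. -/
theorem form_add_form_le {d e ψ : V → ℝ} {C D E : ℝ} (hd : ∀ x, |d x| ≤ C) (he : ∀ x, |e x| ≤ D)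
    (hE : ∀ x, |ψ x| ≤ E) (hfin : (Function.support ψ).Finite)
    (hψ : ∀ x, ψ x = max (d x - e x) 0) : G.form e ψ + G.form ψ ψ ≤ G.form d ψ := by
  have h1 := summable_form (G := G) he hfin
  have h2 := summable_form (G := G) hE hfin
  have h3 := summable_form (G := G) hd hfin
  rw [form, form, form, ← mul_add, ← h1.tsum_add h2]
  refine mul_le_mul_of_nonneg_left ((h1.add h2).tsum_le_tsum (fun p => ?_) h3) (by norm_num)
  rw [← mul_add]
  refine mul_le_mul_of_nonneg_left ?_ (by positivity)
  have := sub_max_mul_ge (d p.1 - e p.1) (d p.2 - e p.2)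
  rw [hψ, hψ]
  linarith

/-- Young's inequality absorbs half of `a² + α b²` from the right-hand side. -/
theorem mul_norm_sq_le {α δ a b c e : ℝ} (hα : 0 < α) (ha : 0 ≤ a) (hb : 0 ≤ b) (hc : c ≤ δ)
    (he : e ≤ δ) (h : a ^ 2 + α * b ^ 2 ≤ c * a + α * (e * b)) :
    α * b ^ 2 ≤ (1 + α) * δ ^ 2 := by
  have h1 : c * a ≤ δ * a := by gcongr
  have h2 : α * (e * b) ≤ α * (δ * b) := by gcongr
  nlinarith [sq_nonneg (a - δ), mul_nonneg hα.le (sq_nonneg (b - δ))]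

/-- In the application `d = u - g`, and `r` is the error in approximating `u` together with its
gradient. Testing `lap d + α d ≤ 0` against `ψ ≥ 0` leaves `Q(ψ) + α ‖ψ‖²` bounded by pairings of
`ψ` with `r`, so `ψ` is as small as the error. -/
theorem norm_max_sub_le {α C : ℝ} (hα : 0 < α) {d : V → ℝ} (hd : ∀ x, |d x| ≤ C)
    (hlap : ∀ x, G.lap d x + α * d x ≤ 0) {r : WithLp 2 (EllTwo V × EllTwo (V × V))}
    (hr : r ∈ G.gradGraph) {ψ : EllTwo V} (hfin : (Function.support (ψ : V → ℝ)).Finite)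
    (hψ : ∀ x, (ψ : V → ℝ) x = max (d x - (r.fst : V → ℝ) x) 0) :
    ‖ψ‖ ≤ √((1 + α) / α) * ‖r‖ := by
  obtain ⟨l, hl⟩ := exists_mem_gradGraph (G := G) (u := ψ) (energy_lt_top_of_finite_support hfin)
  have hform := form_add_form_le (G := G) hd (abs_ellTwo_apply_le r.fst) (abs_ellTwo_apply_le ψ)
    hfin hψ
  have hsum1 := hasSum_form (G := G) hd hfin
  have hsum2 : HasSum (fun y => d y * (ψ : V → ℝ) y) (inner ℝ r.fst ψ + inner ℝ ψ ψ) := by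
    refine ((lp.hasSum_inner (𝕜 := ℝ) r.fst ψ).add (lp.hasSum_inner (𝕜 := ℝ) ψ ψ)).congr_fun
      fun y => ?_
    simp only [RCLike.inner_apply, conj_trivial]
    have : (ψ : V → ℝ) y * (ψ : V → ℝ) y = (d y - (r.fst : V → ℝ) y) * (ψ : V → ℝ) y := by
      rw [hψ]
      rcases le_total (d y - (r.fst : V → ℝ) y) 0 with h | h <;> simp [h]
    rw [this]
    ring
  have hneg : G.form d ψ + α * (inner ℝ r.fst ψ + inner ℝ ψ ψ) ≤ 0 := by
    refine hasSum_le (fun y => ?_) (hsum1.add (hsum2.mul_left α)) hasSum_zero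
    rw [← mul_assoc, ← add_mul]
    refine mul_nonpos_of_nonpos_of_nonneg (hlap y) ?_
    rw [hψ]
    exact le_max_right _ _
  have hi1 : inner ℝ r.snd l = G.form r.fst ψ := inner_snd_eq_form hr hl
  have hi2 : inner ℝ l l = G.form ψ ψ := inner_snd_eq_form hl hl
  rw [real_inner_self_eq_norm_sq] at hi2 hneg
  have hc1 := neg_le_of_abs_le (abs_real_inner_le_norm r.snd l)
  have hc2 := neg_le_of_abs_le (abs_real_inner_le_norm r.fst ψ)
  have hmain : ‖l‖ ^ 2 + α * ‖ψ‖ ^ 2 ≤ ‖r.snd‖ * ‖l‖ + α * (‖r.fst‖ * ‖ψ‖) := by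
    have := mul_le_mul_of_nonneg_left hc2 hα.le
    linarith
  have h := mul_norm_sq_le hα (norm_nonneg l) (norm_nonneg ψ) (WithLp.norm_snd_le (p := 2) (x := r))
    (WithLp.norm_fst_le (p := 2) (x := r)) hmain
  refine le_of_sq_le_sq ?_ (by positivity)
  rw [mul_pow, Real.sq_sqrt (by positivity), div_mul_eq_mul_div, le_div_iff₀ hα]
  linarith

/-- Domination principle: an element of the form domain lies below every bounded nonnegative
function `g` with `(lap + α) u ≤ (lap + α) g`. -/
theorem le_of_lap_add_le {u : EllTwo V} (hu : u ∈ G.formDomain) {g : V → ℝ} {C α : ℝ}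
    (hg0 : ∀ x, 0 ≤ g x) (hgC : ∀ x, g x ≤ C) (hα : 0 < α)
    (h : ∀ x, G.lap u x + α * (u : V → ℝ) x ≤ G.lap g x + α * g x) (x : V) :
    (u : V → ℝ) x ≤ g x := by
  have hg : ∀ x, |g x| ≤ C := fun x => by rw [abs_of_nonneg (hg0 x)]; exact hgC x
  have hd : ∀ y, |(u : V → ℝ) y - g y| ≤ ‖u‖ + C := fun y =>
    (abs_sub _ _).trans (add_le_add (abs_ellTwo_apply_le u y) (hg y))
  have hlap : ∀ y, G.lap (fun y => (u : V → ℝ) y - g y) y + α * ((u : V → ℝ) y - g y) ≤ 0 :=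
    fun y => by
      rw [lap_sub (abs_ellTwo_apply_le u) hg]
      linarith [h y]
  obtain ⟨k, hk⟩ := mem_formDomain_iff.1 hu
  have key : ∀ δ : ℝ, 0 < δ → (u : V → ℝ) x - g x ≤ δ * (1 + √((1 + α) / α)) := by
    intro δ hδ
    obtain ⟨q, hq, hqd⟩ := Metric.mem_closure_iff.1
      (show _ ∈ closure (G.gradGraphFin : Set (WithLp 2 (EllTwo V × EllTwo (V × V)))) from hk) δ hδ
    rw [dist_eq_norm] at hqd
    obtain ⟨r, hr_def⟩ : ∃ r, r = WithLp.toLp 2 (u, k) - q := ⟨_, rfl⟩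
    rw [← hr_def] at hqd
    have hr : r ∈ G.gradGraph := by
      rw [hr_def]; exact G.gradGraph.sub_mem (G.gradGraphMin_le hk) hq.1
    have hrf : ∀ y, (r.fst : V → ℝ) y = (u : V → ℝ) y - (q.fst : V → ℝ) y := fun y => by
      rw [hr_def]; rfl
    -- Since `g ≥ 0`, the positive part of `q.fst - g` vanishes off the support of `q.fst`. It is an
    -- admissible test function even though `g` need not be in `ℓ²`.
    have hψfin : (Function.support fun x => max ((q.fst : V → ℝ) x - g x) 0).Finite := by
      refine hq.2.subset fun y hy => ?_
      contrapose! hy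
      simp only [Function.notMem_support] at hy ⊢
      rw [hy]
      exact max_eq_right (by linarith [hg0 y])
    have hψmem : Memℓp (fun x => max ((q.fst : V → ℝ) x - g x) 0) 2 :=
      (memℓp_zero hψfin).of_exponent_ge zero_le
    obtain ⟨ψ, hψ⟩ : ∃ ψ : EllTwo V, (ψ : V → ℝ) = fun x => max ((q.fst : V → ℝ) x - g x) 0 :=
      ⟨⟨_, hψmem⟩, rfl⟩
    have h0 := norm_max_sub_le hα hd hlap hr (ψ := ψ) (by rw [hψ]; exact hψfin) (fun y => by
      rw [hψ, hrf, sub_sub_sub_cancel_left])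
    have h1 : (u : V → ℝ) x - g x ≤ |(r.fst : V → ℝ) x| + |(ψ : V → ℝ) x| := by
      have h2 := le_max_left ((q.fst : V → ℝ) x - g x) 0
      have h4 := le_abs_self ((r.fst : V → ℝ) x)
      have h5 := le_abs_self ((ψ : V → ℝ) x)
      rw [hrf] at h4
      rw [hψ] at h5
      rw [hψ, hrf]
      linarith
    have h2 := abs_ellTwo_apply_le r.fst x
    have h3 := abs_ellTwo_apply_le ψ x
    have h4 : ‖r.fst‖ ≤ ‖r‖ := WithLp.norm_fst_le (p := 2) (x := r)
    have h5 : √((1 + α) / α) * ‖r‖ ≤ √((1 + α) / α) * δ := by gcongr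
    linarith
  have hlim : Tendsto (fun δ : ℝ => δ * (1 + √((1 + α) / α))) (𝓝[>] 0) (𝓝 0) := by
    have : Continuous fun δ : ℝ => δ * (1 + √((1 + α) / α)) := by fun_prop
    simpa using (this.tendsto 0).mono_left nhdsWithin_le_nhds
  have := ge_of_tendsto hlim (by filter_upwards [self_mem_nhdsWithin] with δ hδ using key δ hδ)
  linarith

/-! ### Positivity of the resolvent and the semigroup. -/

theorem mem_formDomain_of_mem {u w : EllTwo V} (h : (u, w) ∈ formRelation G.gradGraphMin) :
    u ∈ G.formDomain :=
  ((dirichletOperator_eq (G := G)).ge h).1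

theorem lap_resolvent {α : ℝ} (hα : 0 < α) (f : EllTwo V) (x : V) :
    G.lap (relResolvent (formRelation G.gradGraphMin) α f) x +
      α * (relResolvent (formRelation G.gradGraphMin) α f : V → ℝ) x = (f : V → ℝ) x := by
  rw [lap_eq_of_mem (isMaximalMonotone.resolvent_mem hα f) x, lp.coeFn_sub, lp.coeFn_smul,
    Pi.sub_apply, Pi.smul_apply, smul_eq_mul, sub_add_cancel]

/-- Domination by `g = 0`, applied to the resolvent of `-f`. -/
theorem resolvent_nonneg {α : ℝ} (hα : 0 < α) {f : EllTwo V} (hf : ∀ x, 0 ≤ (f : V → ℝ) x)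
    (x : V) : 0 ≤ (relResolvent (formRelation G.gradGraphMin) α f : V → ℝ) x := by
  have hmem := isMaximalMonotone.resolvent_mem (L := formRelation G.gradGraphMin) hα (-f)
  have h := le_of_lap_add_le (g := fun _ => 0) (C := 0) (mem_formDomain_of_mem hmem)
    (fun _ => le_rfl) (fun _ => le_rfl) hα (fun y => by
      rw [lap_resolvent hα]
      simpa [lap] using hf y) x
  rw [map_neg] at h
  simpa using h

/-- The cone of nonnegative functions in `ℓ²`. -/
def nonnegCone (V : Type*) : Submodule ℝ≥0 (EllTwo V) where
  carrier := {f | ∀ x, 0 ≤ (f : V → ℝ) x}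
  add_mem' := fun hf hg x => add_nonneg (hf x) (hg x)
  zero_mem' := fun _ => le_rfl
  smul_mem' := fun c _ hf x => mul_nonneg c.2 (hf x)

theorem isClosed_nonnegCone : IsClosed (nonnegCone V : Set (EllTwo V)) := by
  have : (nonnegCone V : Set (EllTwo V)) = ⋂ x, {f : EllTwo V | 0 ≤ (f : V → ℝ) x} := by
    ext f
    rw [mem_iInter]
    exact Iff.rfl
  rw [this]
  exact isClosed_iInter fun x => isClosed_le continuous_const (continuous_ellTwo_apply x)

theorem delta_nonneg (x y : V) : 0 ≤ (delta x : V → ℝ) y := by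
  classical
  rw [delta_apply]
  split_ifs <;> norm_num

theorem semigroup_nonneg {T : ℝ≥0 → EllTwo V →L[ℝ] EllTwo V}
    (hT : IsSemigroupGeneratedByNeg (formRelation G.gradGraphMin : Set (EllTwo V × EllTwo V)) T)
    (t : ℝ≥0) (x y : V) : 0 ≤ (T t (delta x) : V → ℝ) y :=
  isMaximalMonotone.semigroup_mem_of_resolvent_mem hT isClosed_nonnegCone
    (fun _ hα _ hf => resolvent_nonneg hα hf) t (delta_nonneg x) y

end WeightedGraph

/-! ### The Neumann series of the killed walk. -/

theorem ENNReal.tsum_iSup_of_monotone {ι : Type*} {f : ℕ → ι → ℝ≥0∞}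
    (hf : ∀ i, Monotone fun j => f j i) : ∑' i, ⨆ j, f j i = ⨆ j, ∑' i, f j i := by
  simp only [ENNReal.tsum_eq_iSup_sum]
  rw [iSup_comm]
  exact iSup_congr fun s => ENNReal.finsetSum_iSup_of_monotone hf

theorem ENNReal.iSup_mul_iSup_of_monotone {f g : ℕ → ℝ≥0∞} (hf : Monotone f) (hg : Monotone g) :
    (⨆ j, f j) * ⨆ j, g j = ⨆ j, f j * g j := by
  refine le_antisymm ?_ (iSup_le fun j => mul_le_mul' (le_iSup f j) (le_iSup g j))
  rw [ENNReal.iSup_mul]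
  refine iSup_le fun i => ?_
  rw [ENNReal.mul_iSup]
  refine iSup_le fun j => ?_
  exact (mul_le_mul' (hf (le_max_left i j)) (hg (le_max_right i j))).trans
    (le_iSup (fun k => f k * g k) (max i j))

namespace WeightedGraph

variable {V : Type*} (G : WeightedGraph V)

open Classical in
/-- The terms of the Neumann series of the Green function at `x` of the random walk killed at rate
`α`. -/
def greenTerm (α : ℝ≥0) (x : V) : ℕ → V → ℝ≥0∞
  | 0 => fun y => (if y = x then 1 else 0) / ((G.deg y : ℝ≥0∞) + α)
  | n + 1 => fun y => ∑' z, (G.b y z : ℝ≥0∞) / ((G.deg y : ℝ≥0∞) + α) * greenTerm α x n z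

variable {G}

open Classical in
theorem mul_tsum_greenTerm {α : ℝ≥0} (hα : 0 < α) (x y : V) :
    ((G.deg y : ℝ≥0∞) + α) * ∑' n, G.greenTerm α x n y =
      (if y = x then 1 else 0) + ∑' z, (G.b y z : ℝ≥0∞) * ∑' n, G.greenTerm α x n z := by
  have h0 : (G.deg y : ℝ≥0∞) + α ≠ 0 := by simp [hα.ne']
  have htop : (G.deg y : ℝ≥0∞) + α ≠ ∞ := by simp
  rw [tsum_eq_zero_add' ENNReal.summable, mul_add]
  congr 1
  · rw [greenTerm, ENNReal.mul_div_cancel h0 htop]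
  · simp only [greenTerm]
    rw [ENNReal.tsum_comm, ← ENNReal.tsum_mul_left]
    refine tsum_congr fun z => ?_
    rw [ENNReal.tsum_mul_left, ← mul_assoc, ENNReal.mul_div_cancel h0 htop]

open Classical in
-- Minimality among supersolutions: the partial sum of length `N + 1` arises from that of length `N`
-- by one step of the iteration, which preserves being below `U`.
theorem tsum_greenTerm_le {α : ℝ≥0} (hα : 0 < α) (x : V) {U : V → ℝ≥0∞}
    (hU : ∀ y, (if y = x then 1 else 0) + ∑' z, (G.b y z : ℝ≥0∞) * U z ≤
      ((G.deg y : ℝ≥0∞) + α) * U y) (y : V) : ∑' n, G.greenTerm α x n y ≤ U y := by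
  refine ENNReal.tsum_le_of_sum_range_le fun N => ?_
  induction N generalizing y with
  | zero => simp
  | succ N ih =>
    have h0 : (G.deg y : ℝ≥0∞) + α ≠ 0 := by simp [hα.ne']
    have htop : (G.deg y : ℝ≥0∞) + α ≠ ∞ := by simp
    rw [Finset.sum_range_succ', ← ENNReal.mul_le_mul_iff_right h0 htop]
    refine le_trans ?_ (hU y)
    rw [mul_add, add_comm]
    refine add_le_add ?_ ?_
    · rw [greenTerm, ENNReal.mul_div_cancel h0 htop]
    · simp only [greenTerm]
      rw [← Summable.tsum_finsetSum fun _ _ => ENNReal.summable, ← ENNReal.tsum_mul_left]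
      refine ENNReal.tsum_le_tsum fun z => ?_
      rw [← Finset.mul_sum, ← mul_assoc, ENNReal.mul_div_cancel h0 htop]
      gcongr
      exact ih z

/-- Moving the neighbour sum to the other side removes all subtraction, so the real equation can be
read in `[0, ∞]`, where the series lives. -/
theorem lap_add_eq_iff {v : V → ℝ} {C : ℝ} (hv0 : ∀ x, 0 ≤ v x) (hv : ∀ x, v x ≤ C) (α : ℝ≥0)
    {f : ℝ} (hf : 0 ≤ f) (y : V) : G.lap v y + α * v y = f ↔
      ((G.deg y : ℝ≥0∞) + α) * ENNReal.ofReal (v y) =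
        ENNReal.ofReal f + ∑' z, (G.b y z : ℝ≥0∞) * ENNReal.ofReal (v z) := by
  have hvC : ∀ x, |v x| ≤ C := fun x => by rw [abs_of_nonneg (hv0 x)]; exact hv x
  have hb0 : ∀ z, 0 ≤ (G.b y z : ℝ) * v z := fun z => mul_nonneg (NNReal.coe_nonneg _) (hv0 z)
  have h1 : ∑' z, (G.b y z : ℝ≥0∞) * ENNReal.ofReal (v z) =
      ENNReal.ofReal (∑' z, (G.b y z : ℝ) * v z) := by
    rw [ENNReal.ofReal_tsum_of_nonneg hb0 (summable_b_mul_of_bounded hvC y)]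
    refine tsum_congr fun z => ?_
    rw [ENNReal.ofReal_mul (NNReal.coe_nonneg _), ENNReal.ofReal_coe_nnreal]
  have h2 : ((G.deg y : ℝ≥0∞) + α) * ENNReal.ofReal (v y) =
      ENNReal.ofReal ((G.deg y + α) * v y) := by
    rw [ENNReal.ofReal_mul (by positivity), ENNReal.ofReal_add (by positivity) (by positivity),
      ENNReal.ofReal_coe_nnreal, ENNReal.ofReal_coe_nnreal]
  have hs0 : 0 ≤ ∑' z, (G.b y z : ℝ) * v z := tsum_nonneg hb0
  rw [h1, h2, ← ENNReal.ofReal_add hf hs0, ENNReal.ofReal_eq_ofReal_iff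
    (mul_nonneg (by positivity) (hv0 y)) (add_nonneg hf hs0), lap_eq hvC]
  constructor <;> intro h <;> linarith

open Classical in
theorem ofReal_delta (x y : V) :
    ENNReal.ofReal ((delta x : V → ℝ) y) = if y = x then 1 else 0 := by
  rw [delta_apply]
  split_ifs <;> simp

/-- The resolvent of the Dirichlet Laplacian is given by the Neumann series. -/
theorem ofReal_resolvent_delta {α : ℝ≥0} (hα : 0 < α) (x y : V) :
    ENNReal.ofReal ((relResolvent (formRelation G.gradGraphMin) α (delta x) : V → ℝ) y) =
      ∑' n, G.greenTerm α x n y := by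
  classical
  have hα' : (0 : ℝ) < α := hα
  set u := relResolvent (formRelation G.gradGraphMin) α (delta x) with hu_def
  have hu0 : ∀ z, 0 ≤ (u : V → ℝ) z := resolvent_nonneg hα' (delta_nonneg x)
  have huC : ∀ z, (u : V → ℝ) z ≤ ‖u‖ := fun z => (le_abs_self _).trans (abs_ellTwo_apply_le u z)
  have hlap : ∀ z, G.lap u z + α * (u : V → ℝ) z = (delta x : V → ℝ) z := lap_resolvent hα' _
  have hle : ∀ z, ∑' n, G.greenTerm α x n z ≤ ENNReal.ofReal ((u : V → ℝ) z) :=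
    tsum_greenTerm_le hα x fun z => by
      rw [(lap_add_eq_iff hu0 huC α (delta_nonneg x z) z).1 (hlap z), ofReal_delta]
  have htop : ∀ z, ∑' n, G.greenTerm α x n z ≠ ∞ := fun z =>
    ne_top_of_le_ne_top ENNReal.ofReal_ne_top (hle z)
  refine le_antisymm ?_ (hle y)
  -- The bound just obtained makes the series finite and bounded by `‖u‖`, so it qualifies as the
  -- dominating function.
  rw [← ENNReal.ofReal_toReal (htop y)]
  refine ENNReal.ofReal_le_ofReal ?_
  have hg0 : ∀ z, 0 ≤ (∑' n, G.greenTerm α x n z).toReal := fun z => ENNReal.toReal_nonneg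
  have hgC : ∀ z, (∑' n, G.greenTerm α x n z).toReal ≤ ‖u‖ := fun z =>
    (ENNReal.toReal_le_of_le_ofReal (hu0 z) (hle z)).trans (huC z)
  refine le_of_lap_add_le (g := fun z => (∑' n, G.greenTerm α x n z).toReal)
    (mem_formDomain_of_mem (isMaximalMonotone.resolvent_mem hα' (delta x)))
    hg0 hgC hα' (fun z => ?_) y
  rw [(lap_add_eq_iff hg0 hgC α (delta_nonneg x z) z).2]
  · exact (hlap z).le
  · simp only [ENNReal.ofReal_toReal (htop _), ofReal_delta]
    exact mul_tsum_greenTerm hα x z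

/-! ### The limit of vanishing killing rate. -/

theorem monotone_inv_deg_add {a : ℕ → ℝ≥0} (ha : Antitone a) (y : V) :
    Monotone fun j => ((G.deg y : ℝ≥0∞) + a j)⁻¹ := fun _ _ hij =>
  ENNReal.inv_le_inv.2 (add_le_add le_rfl (ENNReal.coe_le_coe.2 (ha hij)))

theorem iSup_inv_deg_add {a : ℕ → ℝ≥0} (ha : Antitone a) (ha0 : Tendsto a atTop (𝓝 0)) (y : V) :
    ⨆ j, ((G.deg y : ℝ≥0∞) + a j)⁻¹ = ((G.deg y : ℝ≥0∞) + (0 : ℝ≥0))⁻¹ :=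
  iSup_eq_of_tendsto (monotone_inv_deg_add ha y)
    ((tendsto_const_nhds.add (ENNReal.tendsto_coe.2 ha0)).inv)

theorem monotone_greenTerm {a : ℕ → ℝ≥0} (ha : Antitone a) (x : V) (n : ℕ) (y : V) :
    Monotone fun j => G.greenTerm (a j) x n y := by
  induction n generalizing y with
  | zero =>
    intro i j hij
    simp only [greenTerm, div_eq_mul_inv]
    exact mul_le_mul' le_rfl (monotone_inv_deg_add ha y hij)
  | succ n ih =>
    intro i j hij
    simp only [greenTerm, div_eq_mul_inv]
    exact ENNReal.tsum_le_tsum fun z =>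
      mul_le_mul' (mul_le_mul' le_rfl (monotone_inv_deg_add ha y hij)) (ih z hij)

theorem iSup_greenTerm {a : ℕ → ℝ≥0} (ha : Antitone a) (ha0 : Tendsto a atTop (𝓝 0)) (x : V)
    (n : ℕ) (y : V) : ⨆ j, G.greenTerm (a j) x n y = G.greenTerm 0 x n y := by
  induction n generalizing y with
  | zero =>
    simp only [greenTerm, div_eq_mul_inv]
    rw [← ENNReal.mul_iSup, iSup_inv_deg_add ha ha0]
  | succ n ih =>
    have hm : ∀ z, Monotone fun j => (G.b y z : ℝ≥0∞) * ((G.deg y : ℝ≥0∞) + a j)⁻¹ :=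
      fun z i j hij => mul_le_mul' le_rfl (monotone_inv_deg_add ha y hij)
    simp only [greenTerm, div_eq_mul_inv]
    rw [← ENNReal.tsum_iSup_of_monotone fun z i j hij =>
      mul_le_mul' (hm z hij) (monotone_greenTerm ha x n z hij)]
    refine tsum_congr fun z => ?_
    rw [← ENNReal.iSup_mul_iSup_of_monotone (hm z) (monotone_greenTerm ha x n z), ih,
      ← ENNReal.mul_iSup, iSup_inv_deg_add ha ha0]

theorem iSup_tsum_greenTerm {a : ℕ → ℝ≥0} (ha : Antitone a) (ha0 : Tendsto a atTop (𝓝 0))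
    (x y : V) : ⨆ j, ∑' n, G.greenTerm (a j) x n y = ∑' n, G.greenTerm 0 x n y := by
  rw [← ENNReal.tsum_iSup_of_monotone fun n => monotone_greenTerm ha x n y]
  exact tsum_congr fun n => iSup_greenTerm ha ha0 x n y

/-- A path to a different vertex has a first edge. -/
theorem deg_pos [Nontrivial V] (hG : G.Connected) (x : V) : 0 < G.deg x := by
  obtain ⟨y, hy⟩ := exists_ne x
  rcases Relation.ReflTransGen.cases_head (hG x y) with h | ⟨z, hz, -⟩
  · exact absurd h.symm hy
  · exact hz.trans_le ((G.b_summable x).le_tsum z fun _ _ => zero_le)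

theorem summable_transition (x : V) : Summable (G.transition x) :=
  (G.b_summable x).div_const _

theorem tsum_transition_le_one (x : V) : ∑' y, G.transition x y ≤ 1 := by
  simp only [transition, div_eq_mul_inv]
  rw [NNReal.tsum_mul_right]
  exact mul_inv_le_one

theorem transitionPow_le_one (n : ℕ) (x y : V) : G.transitionPow n x y ≤ 1 := by
  induction n generalizing x with
  | zero => simp only [transitionPow]; split_ifs <;> simp
  | succ n ih =>
    have h : ∀ z, G.transition x z * G.transitionPow n z y ≤ G.transition x z := fun z =>
      mul_le_of_le_one_right zero_le (ih z)
    exact ((NNReal.summable_of_le h (summable_transition x)).tsum_le_tsum h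
      (summable_transition x)).trans (tsum_transition_le_one x)

/-- Each step contributes `b(y,z) / deg y`, a transition probability; the terminal vertex of the
path contributes the remaining `1 / deg x`. -/
theorem greenTerm_zero_eq (hdeg : ∀ x, 0 < G.deg x) (x : V) (n : ℕ) (y : V) :
    G.greenTerm 0 x n y = 1 / (G.deg x : ℝ≥0∞) * (G.transitionPow n y x : ℝ≥0∞) := by
  induction n generalizing y with
  | zero =>
    simp only [greenTerm, transitionPow, ENNReal.coe_zero, add_zero]
    split_ifs with h
    · simp [h]
    · simp
  | succ n ih =>
    have hs : Summable fun z => G.transition y z * G.transitionPow n z x :=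
      NNReal.summable_of_le (fun z => mul_le_of_le_one_right zero_le (transitionPow_le_one n z x))
        (summable_transition y)
    simp only [greenTerm, transitionPow, ENNReal.coe_zero, add_zero, ENNReal.coe_tsum hs,
      ← ENNReal.tsum_mul_left, ih]
    refine tsum_congr fun z => ?_
    rw [transition, ENNReal.coe_mul, ENNReal.coe_div (hdeg y).ne']
    ring

theorem lintegral_exp_mul_semigroup {T : ℝ≥0 → EllTwo V →L[ℝ] EllTwo V}
    (hT : IsSemigroupGeneratedByNeg (formRelation G.gradGraphMin : Set (EllTwo V × EllTwo V)) T)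
    {α : ℝ≥0} (hα : 0 < α) (x y : V) :
    ∫⁻ t in Ioi (0 : ℝ), ENNReal.ofReal (Real.exp (-α * t) * (T t.toNNReal (delta x) : V → ℝ) y) =
      ∑' n, G.greenTerm α x n y := by
  rw [← ofReal_resolvent_delta hα]
  have h := isMaximalMonotone.integral_exp_mul_semigroup hT (NNReal.coe_pos.2 hα)
    (lp.evalCLM ℝ (fun _ : V => ℝ) (p := 2) y) (delta x)
  have hint := isMaximalMonotone.integrableOn_exp_mul_semigroup hT (NNReal.coe_pos.2 hα)
    (lp.evalCLM ℝ (fun _ : V => ℝ) (p := 2) y) (delta x)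
  exact (ofReal_integral_eq_lintegral_ofReal hint (Eventually.of_forall fun t =>
    mul_nonneg (Real.exp_pos _).le (semigroup_nonneg hT _ x y))).symm.trans
      (congrArg ENNReal.ofReal h)

/-- Take `α = 1/(j+1)`. Positivity of the semigroup makes the integrands increase with `j`, so
monotone convergence matches the monotone limit of the series, without any finiteness. -/
theorem lintegral_semigroup {T : ℝ≥0 → EllTwo V →L[ℝ] EllTwo V}
    (hT : IsSemigroupGeneratedByNeg (formRelation G.gradGraphMin : Set (EllTwo V × EllTwo V)) T)
    (x y : V) :
    ∫⁻ t in Ioi (0 : ℝ), ENNReal.ofReal ((T t.toNNReal (delta x) : V → ℝ) y) =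
      ∑' n, G.greenTerm 0 x n y := by
  let a : ℕ → ℝ≥0 := fun j => 1 / ((j : ℝ≥0) + 1)
  have ha : Antitone a := fun i j hij => by
    simp only [a]
    gcongr
  have ha0 : Tendsto a atTop (𝓝 0) := tendsto_one_div_add_atTop_nhds_zero_nat
  have hapos : ∀ j, 0 < a j := fun j => by positivity
  rw [← iSup_tsum_greenTerm ha ha0]
  simp only [← lintegral_exp_mul_semigroup hT (hapos _)]
  have hcont : Continuous fun t : ℝ => (T t.toNNReal (delta x) : V → ℝ) y :=
    (continuous_ellTwo_apply y).comp (hT.continuous_orbit_real (delta x))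
  have hmono : ∀ t ∈ Ioi (0 : ℝ), Monotone fun j =>
      ENNReal.ofReal (Real.exp (-(a j) * t) * (T t.toNNReal (delta x) : V → ℝ) y) :=
    fun t ht i j hij => by
      refine ENNReal.ofReal_le_ofReal
        (mul_le_mul_of_nonneg_right (Real.exp_le_exp.2 ?_) (semigroup_nonneg hT _ x y))
      have h1 : (a j : ℝ) ≤ a i := NNReal.coe_le_coe.2 (ha hij)
      have h2 : (0 : ℝ) < t := ht
      nlinarith
  have hmeas : ∀ j, Measurable fun t : ℝ =>
      ENNReal.ofReal (Real.exp (-(a j) * t) * (T t.toNNReal (delta x) : V → ℝ) y) := fun j =>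
    (((by fun_prop : Continuous fun t : ℝ => Real.exp (-(a j) * t)).mul
      hcont).measurable).ennreal_ofReal
  rw [← lintegral_iSup_ae hmeas]
  · refine setLIntegral_congr_fun measurableSet_Ioi fun t ht => ?_
    refine (iSup_eq_of_tendsto (hmono t ht) (ENNReal.tendsto_ofReal ?_)).symm
    have h1 : Continuous fun s : ℝ => Real.exp (-s * t) * (T t.toNNReal (delta x) : V → ℝ) y := by
      fun_prop
    have h2 := (h1.tendsto 0).comp ((NNReal.continuous_coe.tendsto 0).comp ha0)
    simpa [Function.comp_def] using h2
  · intro j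
    filter_upwards [self_mem_ae_restrict measurableSet_Ioi] with t ht
    exact hmono t ht (Nat.le_succ j)

end WeightedGraph

end

theorem mainTheorem1 {V : Type*} [Countable V] [Infinite V]
    (G : WeightedGraph V) (hG : G.Connected) :
    -- the semigroup `e^{-tL^D}` exists, is unique, and is what `expNeg` denotes
    (∃! T : ℝ≥0 → EllTwo V →L[ℝ] EllTwo V, IsSemigroupGeneratedByNeg G.dirichletOperator T) ∧
    IsSemigroupGeneratedByNeg G.dirichletOperator (expNeg G.dirichletOperator) ∧
    -- the integrand is nonnegative, so that the integral makes sense in `[0, ∞]`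
    (∀ (t : ℝ≥0) (x y : V), 0 ≤ (expNeg G.dirichletOperator t (delta x) : V → ℝ) y) ∧
    -- the formula, as an identity in `[0, ∞]`
    ∀ x y : V,
      ∫⁻ t in Ioi (0 : ℝ),
          ENNReal.ofReal ((expNeg G.dirichletOperator t.toNNReal (delta x) : V → ℝ) y) =
        (1 / (G.deg x : ℝ≥0∞)) * ∑' n : ℕ, (G.transitionPow n y x : ℝ≥0∞) := by
  have hL := WeightedGraph.isMaximalMonotone (G := G)
  rw [WeightedGraph.dirichletOperator_eq]
  obtain ⟨T, hT, -⟩ := hL.exists_semigroup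
  have hex : ∃ T, IsSemigroupGeneratedByNeg
      (formRelation G.gradGraphMin : Set (EllTwo V × EllTwo V)) T := ⟨T, hT⟩
  have hexp : IsSemigroupGeneratedByNeg (formRelation G.gradGraphMin : Set (EllTwo V × EllTwo V))
      (expNeg (formRelation G.gradGraphMin : Set (EllTwo V × EllTwo V))) := by
    rw [expNeg, dif_pos hex]
    exact hex.choose_spec
  refine ⟨⟨T, hT, fun S hS => hL.semigroup_unique hS hT⟩, hexp,
    WeightedGraph.semigroup_nonneg hexp, fun x y => ?_⟩
  rw [WeightedGraph.lintegral_semigroup hexp, ← ENNReal.tsum_mul_left]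
  exact tsum_congr fun n => WeightedGraph.greenTerm_zero_eq (WeightedGraph.deg_pos hG) x n y
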